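/- **Theorem (Convergence Lemma).** Let $X$ be a complex Banach space, $\omega\ge 0$, and let $v:\mathbb R\to[1,\infty)$ be strongly admissible, i.e. measurable with $\sup_{s,t}\frac{v(s+t)}{v(s)+v(t)}<\infty$ and $\frac1v\in L^2(\mathbb R)$. *Function spaces.* Let $\mathrm{St}_\theta=\{z\in\mathbb C: |\operatorname{Im} z|<\theta\}$ for $\theta>0$ and $\mathrm{St}_0=\mathbb R$. Let $\mathrm W^2_v(\mathrm{St}_\omega)$ be the space of all functions $\hat g(z)=\int_{\mathbb R}e^{-isz}g(s)\,ds$ ($z\in \mathrm{St}_\omega$) with $g\in L^2(\mathbb R)$ and $v e^{\omega|\cdot|}g\in L^2(\mathbb R)$, normed by $\|\hat g\|_{\mathrm W^2_v(\mathrm{St}_\omega)}=\|v e^{\omega|\cdot|}g\|_{L^2}$; this is an algebra under pointwise multiplication. Let $\mathrm{H\ddot or}^2_v(\mathrm{St}_\omega)$ be the space of all $f:\mathrm{St}_\omega\to\mathbb C$ such that $e^{-(\cdot-t)^2}f\in \mathrm W^2_v(\mathrm{St}_\omega)$ for all $t\in\mathbb R$ and $\sup_{t\in\mathbb R}\|e^{-(\cdot-t)^2}f\|_{\mathrm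 W^2_v(\mathrm{St}_\omega)}<\infty$. Let $\mathrm H^\infty_0[\overline{\mathrm{St}}_\omega]$ be the set of functions $\psi$ that, for some $\theta>\omega$, are holomorphic on $\mathrm{St}_\theta$ with $\sup_{z\in \mathrm{St}_\theta}(1+|\operatorname{Re}z|)^\alpha|\psi(z)|<\infty$ for all $\alpha>0$, and let $\mathcal E[\overline{\mathrm{St}}_\omega]$ be the set of functions $\psi$ that, for some $\theta>\omega$, are bounded and holomorphic on $\mathrm{St}_\theta$ with $\sup_{|r|<\theta}\int_{\mathbb R}|\psi(s+ir)|\,ds<\infty$. *Functional calculus.* A linear operator $A$ on $X$ has a bounded $\mathrm W^2_v(\mathrm{St}_\omega)$-calculus if there is a bounded algebra homomorphism $\Psi:\mathrm W^2_v(\mathrm{St}_\omega)\to\mathcal L(X)$ with $\Psi((\lambda-\mathbf z)^{-1})=R(\lambda,A)$ for some $\lambda$ with $|\operatorname{Im}\lambda|>\omega$. For such $A$ and $\psi\in\mathcal E[\overline{\mathrm{St}}_\omega]$ (with associated $\theta$) let $\psi(A)=\frac1{2\pi i}\int_{\partial \mathrm{St}_\delta}\psi(w)R(w,A)\,dw\in\mathcal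 L(X)$, where $\omega<\delta<\theta$. The closure of the map $\psi\mapsto\psi(A)$ in $\mathrm W^2_v(\mathrm{St}_\omega)\times\mathcal L(X)$ is the elementary Sobolev calculus $e\mapsto e(A)$. For $f:\mathrm{St}_\omega\to\mathbb C$ let $[f]$ be the set of all $e$ such that $e$ and $ef$ belong to the domain of the elementary Sobolev calculus; the (possibly unbounded) operator $f(A)$ is defined by: $f(A)x=y$ if and only if $e(A)y=(ef)(A)x$ for all $e\in[f]$ (this is single-valued if $\bigcap_{e\in[f]}\ker e(A)=\{0\}$, as is the case for $f\in\mathrm{H\ddot or}^2_v(\mathrm{St}_\omega)$). A set $\mathcal D\subseteq\mathcal E[\overline{\mathrm{St}}_\omega]$ is ample if $\overline{\operatorname{span}}\bigcup_{\psi\in\mathcal D}\operatorname{ran}\psi(A)=X$. *Statement.* Let $A$ be an operator on $X$ with a bounded $\mathrm W^2_v(\mathrm{St}_\omega)$-calculus. Let $f\in\mathrm{H\ddot or}^2_v(\mathrm{St}_\omega)$ and let $(f_n)_n$ be a sequence in $\mathrm{H\ddot or}^2_v(\mathrm{St}_\omega)$ such that 1. there is an ample set $\mathcal D\subseteq\mathrm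 H^\infty_0[\overline{\mathrm{St}}_\omega]$ with $\|\psi(f_n-f)\|_{\mathrm W^2_v(\mathrm{St}_\omega)}\to0$ as $n\to\infty$ for all $\psi\in\mathcal D$; 2. $f_n(A)\in\mathcal L(X)$ for all $n$ and $\sup_n\|f_n(A)\|<\infty$. Then $f(A)\in\mathcal L(X)$ and $f_n(A)\to f(A)$ strongly on $X$. -/

import Mathlib

open MeasureTheory Filter Topology
open scoped ENNReal NNReal

noncomputable section

namespace HorCalc

/-! ### Weights -/

/-- Strongly admissible weights `v : ℝ → [1, ∞)`: measurable, `v (s + t) ≤ M (v s + v t)` for some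
constant `M`, and `1 / v ∈ L²(ℝ)`. -/
structure StronglyAdmissible (v : ℝ → ℝ) : Prop where
  measurable : Measurable v
  one_le : ∀ s, 1 ≤ v s
  subadd : ∃ M : ℝ, ∀ s t, v (s + t) ≤ M * (v s + v t)
  inv_memLp : MemLp (fun s => 1 / v s) 2 volume

/-! ### Strips and function spaces on strips -/

/-- The open horizontal strip `{z : |Im z| < θ}`. -/
def openStrip (θ : ℝ) : Set ℂ := {z | |z.im| < θ}

/-- The strip `St_ω`, which is the open strip of height `ω` if `ω > 0` and the real line if
`ω = 0`. -/
def strip (ω : ℝ) : Set ℂ := if ω = 0 then {z | z.im = 0} else openStrip ω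

/-- The function `v(s) e^{ω|s|} g(s)`. -/
def weighted (v : ℝ → ℝ) (ω : ℝ) (g : ℝ → ℂ) : ℝ → ℂ :=
  fun s => ((v s * Real.exp (ω * |s|) : ℝ) : ℂ) * g s

/-- `g ∈ L²_{v,ω}(ℝ)`. -/
def MemWeightedL2 (v : ℝ → ℝ) (ω : ℝ) (g : ℝ → ℂ) : Prop :=
  MemLp g 2 volume ∧ MemLp (weighted v ω g) 2 volume

/-- The (Fourier) transform `ĝ(z) = ∫ e^{-i s z} g(s) ds`, as a function on `St_ω`. -/
def fourierStrip (ω : ℝ) (g : ℝ → ℂ) : strip ω → ℂ :=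
  fun z => ∫ s : ℝ, Complex.exp (-Complex.I * s * (z : ℂ)) * g s

theorem abs_im_le_of_mem_strip {ω : ℝ} {z : ℂ} (hz : z ∈ strip ω) : |z.im| ≤ ω := by
  unfold strip at hz
  split_ifs at hz with h
  · have h0 : z.im = 0 := hz
    simp [h0, h]
  · exact le_of_lt hz

/-- For strongly admissible `v` and `g ∈ L²_{v,ω}(ℝ)` the integral defining `ĝ` converges
absolutely at each point of the strip. -/
theorem integrable_fourierStrip {v : ℝ → ℝ} (hv : StronglyAdmissible v) {ω : ℝ} {g : ℝ → ℂ}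
    (hg : MemWeightedL2 v ω g) (z : strip ω) :
    Integrable (fun s : ℝ => Complex.exp (-Complex.I * s * (z : ℂ)) * g s) volume := by
  have h1 : Integrable (fun s => (1 / v s) * ‖weighted v ω g s‖) volume :=
    hv.inv_memLp.integrable_mul hg.2.norm
  refine h1.mono' ?_ ?_
  · refine AEStronglyMeasurable.mul ?_ hg.1.1
    exact (by fun_prop : Continuous fun s : ℝ =>
      Complex.exp (-Complex.I * s * (z : ℂ))).aestronglyMeasurable
  · refine Eventually.of_forall fun s => ?_
    have hpos : 0 < v s := lt_of_lt_of_le one_pos (hv.one_le s)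
    have hz := abs_im_le_of_mem_strip z.2
    have e1 : ‖Complex.exp (-Complex.I * s * (z : ℂ))‖ = Real.exp (s * (z : ℂ).im) := by
      rw [Complex.norm_exp]; congr 1; simp
    have e2 : s * (z : ℂ).im ≤ ω * |s| := by
      calc s * (z : ℂ).im ≤ |s * (z : ℂ).im| := le_abs_self _
        _ = |(z : ℂ).im| * |s| := by rw [abs_mul, mul_comm]
        _ ≤ ω * |s| := mul_le_mul_of_nonneg_right hz (abs_nonneg _)
    have e3 : (1 / v s) * ‖weighted v ω g s‖ = Real.exp (ω * |s|) * ‖g s‖ := by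
      unfold weighted
      rw [norm_mul, Complex.norm_real, Real.norm_of_nonneg (by positivity)]
      field_simp
    rw [e3, norm_mul, e1]
    exact mul_le_mul_of_nonneg_right (Real.exp_le_exp.2 e2) (norm_nonneg _)

/-- The generalized Sobolev space `W²_v(St_ω) = {ĝ : g ∈ L²_{v,ω}(ℝ)}`, as a space of functions on
`St_ω`. (If `ω = 0` its elements are the continuous representatives.) -/
def sobolevSpace {v : ℝ → ℝ} (hv : StronglyAdmissible v) (ω : ℝ) :
    Submodule ℂ (strip ω → ℂ) where
  carrier := {f | ∃ g, MemWeightedL2 v ω g ∧ f = fourierStrip ω g}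
  zero_mem' := by
    refine ⟨0, ⟨MemLp.zero, ?_⟩, ?_⟩
    · have h : weighted v ω 0 = 0 := by funext s; simp [weighted]
      rw [h]; exact MemLp.zero
    · funext z; simp [fourierStrip]
  add_mem' := by
    rintro _ _ ⟨g, hg, rfl⟩ ⟨h, hh, rfl⟩
    refine ⟨g + h, ⟨hg.1.add hh.1, ?_⟩, ?_⟩
    · have e : weighted v ω (g + h) = weighted v ω g + weighted v ω h := by
        funext s; simp [weighted, mul_add]
      rw [e]; exact hg.2.add hh.2
    · funext z
      simp only [fourierStrip, Pi.add_apply, mul_add]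
      exact (integral_add (integrable_fourierStrip hv hg z)
        (integrable_fourierStrip hv hh z)).symm
  smul_mem' := by
    rintro c _ ⟨g, hg, rfl⟩
    refine ⟨c • g, ⟨hg.1.const_smul c, ?_⟩, ?_⟩
    · have e : weighted v ω (c • g) = c • weighted v ω g := by
        funext s; simp [weighted, mul_left_comm]
      rw [e]; exact hg.2.const_smul c
    · funext z
      simp only [fourierStrip, Pi.smul_apply, smul_eq_mul, mul_left_comm _ c]
      exact (integral_const_mul c _).symm

/-- The norm `‖ĝ‖_{W²_v(St_ω)} = ‖v e^{ω|·|} g‖_{L²}`, extended by the value `∞` to functions that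
do not belong to `W²_v(St_ω)`. (The function `g` is determined almost everywhere by `ĝ`.) -/
def sobolevNorm (v : ℝ → ℝ) (ω : ℝ) (f : strip ω → ℂ) : ℝ≥0∞ :=
  ⨅ (g : ℝ → ℂ) (_ : MemWeightedL2 v ω g ∧ f = fourierStrip ω g), eLpNorm (weighted v ω g) 2 volume

/-- The Gaussian function `e^{-z²}`. -/
def gauss (z : ℂ) : ℂ := Complex.exp (-z ^ 2)

/-- The Hörmander norm `sup_t ‖τ_t G · f‖_{W²_v(St_ω)}`, where `G` is the Gaussian. -/
def horNorm (v : ℝ → ℝ) (ω : ℝ) (f : strip ω → ℂ) : ℝ≥0∞ :=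
  ⨆ t : ℝ, sobolevNorm v ω (fun z => gauss ((z : ℂ) - t) * f z)

/-- The generalized Hörmander space `Hör²_v(St_ω)`. -/
def horSpace (v : ℝ → ℝ) (ω : ℝ) : Set (strip ω → ℂ) := {f | horNorm v ω f < ∞}

/-- Restriction to `St_ω` of a function given on a larger set. -/
def toStrip (ω : ℝ) (ψ : ℂ → ℂ) : strip ω → ℂ := fun z => ψ z

/-- The holomorphic Schwartz functions on the open strip of height `θ`. -/
def holSchwartz (θ : ℝ) : Set (ℂ → ℂ) :=
  {ψ | DifferentiableOn ℂ ψ (openStrip θ) ∧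
    ∀ α : ℝ, 0 < α → ∃ C : ℝ, ∀ z ∈ openStrip θ, ‖ψ z‖ ≤ C / (1 + |z.re|) ^ α}

/-- The union of the spaces `holSchwartz θ` over all `θ > ω`. -/
def holSchwartzGerm (ω : ℝ) : Set (ℂ → ℂ) := {ψ | ∃ θ, ω < θ ∧ ψ ∈ holSchwartz θ}

/-- Elementary functions `𝓔(St_θ) = H^∞(St_θ) ∩ H¹(St_θ)`. -/
def elementary (θ : ℝ) : Set (ℂ → ℂ) :=
  {ψ | DifferentiableOn ℂ ψ (openStrip θ) ∧
    (∃ C : ℝ, ∀ z ∈ openStrip θ, ‖ψ z‖ ≤ C) ∧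
    (⨆ (r : ℝ) (_ : |r| < θ), ∫⁻ s : ℝ, ‖ψ ((s : ℂ) + (r : ℂ) * Complex.I)‖ₑ) < ∞}

/-- The union of the spaces `elementary θ` over all `θ > ω`. -/
def elementaryGerm (ω : ℝ) : Set (ℂ → ℂ) := {ψ | ∃ θ, ω < θ ∧ ψ ∈ elementary θ}

/-! ### Operators and functional calculus -/

variable {X : Type*} [NormedAddCommGroup X] [NormedSpace ℂ X]

/-- `R` is the (bounded, everywhere defined) inverse of `l - A`. -/
def IsResolventAt (A : X →ₗ.[ℂ] X) (l : ℂ) (R : X →L[ℂ] X) : Prop :=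
  (∀ x : X, ∃ h : R x ∈ A.domain, l • R x - A ⟨R x, h⟩ = x) ∧
    ∀ x : A.domain, R (l • (x : X) - A x) = x

open Classical in
/-- The resolvent `R(l, A)` for `l` in the resolvent set of `A` (and `0` otherwise). -/
def resolventOp (A : X →ₗ.[ℂ] X) (l : ℂ) : X →L[ℂ] X :=
  if h : ∃ R, IsResolventAt A l R then h.choose else 0

/-- `A` has a bounded `W²_v(St_ω)`-calculus: there is a bounded algebra homomorphism
`Ψ : W²_v(St_ω) → L(X)` with `Ψ((l - z)⁻¹) = R(l, A)` for some `l` with `|Im l| > ω`. (As `v` is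
strongly admissible, `W²_v(St_ω)` is closed under pointwise products, so `h` below always exists.) -/
def HasBoundedSobolevCalculus {v : ℝ → ℝ} (hv : StronglyAdmissible v) (ω : ℝ)
    (A : X →ₗ.[ℂ] X) : Prop :=
  ∃ Ψ : sobolevSpace hv ω →ₗ[ℂ] (X →L[ℂ] X),
    (∀ f g h : sobolevSpace hv ω, (h : strip ω → ℂ) = (f : strip ω → ℂ) * (g : strip ω → ℂ) →
      Ψ h = Ψ f * Ψ g) ∧
    (∃ C : ℝ≥0, ∀ f : sobolevSpace hv ω, ‖Ψ f‖ₑ ≤ C * sobolevNorm v ω f) ∧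
    ∃ l : ℂ, ω < |l.im| ∧ ∃ r : sobolevSpace hv ω,
      (r : strip ω → ℂ) = (fun z : strip ω => (l - (z : ℂ))⁻¹) ∧ IsResolventAt A l (Ψ r)

/-- The Cauchy integral `(2πi)⁻¹ ∫ ψ(w) R(w, A) dw` over the positively oriented boundary of the
strip of height `δ`. -/
def cauchyOp (A : X →ₗ.[ℂ] X) (δ : ℝ) (ψ : ℂ → ℂ) : X →L[ℂ] X :=
  (2 * (Real.pi : ℂ) * Complex.I)⁻¹ •
    ((∫ s : ℝ, ψ ((s : ℂ) - (δ : ℂ) * Complex.I) •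
        resolventOp A ((s : ℂ) - (δ : ℂ) * Complex.I)) -
      ∫ s : ℝ, ψ ((s : ℂ) + (δ : ℂ) * Complex.I) •
        resolventOp A ((s : ℂ) + (δ : ℂ) * Complex.I))

open Classical in
/-- The elementary calculus `ψ ↦ ψ(A)` on elementary functions (and `0` otherwise): the Cauchy
integral over the boundary of a strip of height `δ`, where `ω < δ < θ` and `ψ ∈ 𝓔(St_θ)`. By
Cauchy's theorem, the value does not depend on the choice of `δ` if `A` is of strip type. -/
def elemCalc (ω : ℝ) (A : X →ₗ.[ℂ] X) (ψ : ℂ → ℂ) : X →L[ℂ] X :=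
  if h : ∃ δ, ω < δ ∧ ∃ θ, δ < θ ∧ ψ ∈ elementary θ then cauchyOp A h.choose ψ else 0

/-- A set `D` of elementary functions is ample if the ranges of the operators `ψ(A)`, `ψ ∈ D`, span
a dense subspace. -/
def Ample (ω : ℝ) (A : X →ₗ.[ℂ] X) (D : Set (ℂ → ℂ)) : Prop :=
  D ⊆ elementaryGerm ω ∧
    closure (Submodule.span ℂ (⋃ ψ ∈ D, Set.range (elemCalc ω A ψ)) : Set X) = Set.univ

/-- The elementary Sobolev calculus: the closure of (the graph of) the elementary calculus in
`W²_v(St_ω) × L(X)`. -/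
def SobolevCalc {v : ℝ → ℝ} (hv : StronglyAdmissible v) (ω : ℝ) (A : X →ₗ.[ℂ] X)
    (f : strip ω → ℂ) (T : X →L[ℂ] X) : Prop :=
  f ∈ sobolevSpace hv ω ∧ ∃ ψ : ℕ → ℂ → ℂ, (∀ n, ψ n ∈ elementaryGerm ω) ∧
    Tendsto (fun n => sobolevNorm v ω (toStrip ω (ψ n) - f)) atTop (𝓝 0) ∧
    Tendsto (fun n => elemCalc ω A (ψ n)) atTop (𝓝 T)

/-- The operator `f(A)`, identified with its graph, for a function `f` on `St_ω`. It is defined by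
algebraic extension of the elementary Sobolev calculus: `f(A) x = y` if and only if
`e(A) y = (e f)(A) x` for all functions `e` such that `e` and `e f` belong to the domain of the
elementary Sobolev calculus. This relation is single-valued if and only if the operators `e(A)` for
these `e` have no common kernel, i.e. if `f` belongs to the domain of the extended calculus. -/
def funCalc {v : ℝ → ℝ} (hv : StronglyAdmissible v) (ω : ℝ) (A : X →ₗ.[ℂ] X)
    (f : strip ω → ℂ) : Submodule ℂ (X × X) where
  carrier := {p | ∀ (e : strip ω → ℂ) (T S : X →L[ℂ] X),
    SobolevCalc hv ω A e T → SobolevCalc hv ω A (e * f) S → T p.2 = S p.1}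
  zero_mem' := by intro e T S _ _; simp
  add_mem' := by
    intro p q hp hq e T S h1 h2
    simp [hp e T S h1 h2, hq e T S h1 h2]
  smul_mem' := by
    intro c p hp e T S h1 h2
    simp [hp e T S h1 h2]

/-- `f(A) ∈ L(X)`, and `f(A) = T`. -/
def FunCalcEq {v : ℝ → ℝ} (hv : StronglyAdmissible v) (ω : ℝ) (A : X →ₗ.[ℂ] X)
    (f : strip ω → ℂ) (T : X →L[ℂ] X) : Prop :=
  funCalc hv ω A f = LinearMap.graph (T : X →ₗ[ℂ] X)

end HorCalc

end

noncomputable section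

namespace HorCalc

/-! The functional calculus `Ψ` turns out to be the whole elementary Sobolev calculus: on an
elementary function it is the Cauchy integral, because the resolvent is an absolutely convergent
Cauchy integral already in `W²_v(St_ω)`, and Gaussians, which are elementary, span a dense subspace
of `W²_v(St_ω)`. Hence `(x, y) ∈ f(A)` means `Ψ(p) y = Ψ(p f) x` for all `p` with `p, p f ∈ W²_v`,
which is a closed relation; it is single-valued for `f ∈ Hör²_v`, as `e^{-z²} f ∈ W²_v` and
`Ψ(e^{-z²})` is injective.

Now let `p ∈ W²_v` with `p (f_n - f) → 0` in `W²_v`. Since `p f_n = p f + p (f_n - f)`, the pair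
`(Ψ(p) y, f_n(A) Ψ(p) y - Ψ(p (f_n - f)) y)` belongs to `f(A)` for all large `n`. By
single-valuedness its second entry does not depend on `n`, so `f_n(A) Ψ(p) y` converges, and its
limit is the image of `Ψ(p) y` under `f(A)`. By uniform boundedness and ampleness convergence
extends to all of `X`, and closedness of `f(A)` identifies the limit. -/

/-! ### Growth of weights -/

theorem exists_forall_abs_le_le_of_subadd {v : ℝ → ℝ} (hv : Measurable v) {M : ℝ} (hM : 0 ≤ M)
    (hsub : ∀ s t, v (s + t) ≤ M * (v s + v t)) :
    ∃ δ > 0, ∃ B, ∀ s, |s| ≤ δ → v s ≤ B := by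
  let E (n : ℕ) : Set ℝ := {s | v s ≤ n ∧ v (-s) ≤ n}
  have hE_meas (n : ℕ) : MeasurableSet (E n) :=
    (measurableSet_le hv measurable_const).inter
      (measurableSet_le (hv.comp measurable_neg) measurable_const)
  have hE_cover : ⋃ n, E n = Set.univ := by
    refine Set.eq_univ_of_forall fun s => Set.mem_iUnion.2 ?_
    obtain ⟨n, hn⟩ := exists_nat_ge (max (v s) (v (-s)))
    exact ⟨n, max_le_iff.1 hn⟩
  obtain ⟨n, hn⟩ : ∃ n, 0 < volume (E n) := by
    by_contra! h
    have : volume (⋃ n, E n) = 0 := measure_iUnion_null fun n => nonpos_iff_eq_zero.1 (h n)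
    simp [hE_cover] at this
  -- Steinhaus: the difference set of a set of positive measure is a neighbourhood of `0`.
  obtain ⟨δ, hδ, hball⟩ := Metric.nhds_basis_closedBall.mem_iff.1
    (Measure.sub_mem_nhds_zero_of_addHaar_pos volume (E n) (hE_meas n) hn)
  refine ⟨δ, hδ, M * (n + n), fun s hs => ?_⟩
  obtain ⟨a, ha, b, hb, rfl⟩ := hball (mem_closedBall_zero_iff.2 hs)
  calc v (a - b) = v (a + -b) := by rw [sub_eq_add_neg]
    _ ≤ M * (v a + v (-b)) := hsub a (-b)
    _ ≤ M * (n + n) := mul_le_mul_of_nonneg_left (add_le_add ha.1 hb.2) hM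

section Doubling

variable {v : ℝ → ℝ} {K δ B : ℝ} (hK : 1 ≤ K) (hB : ∀ s, |s| ≤ δ → v s ≤ B)
  (hdouble : ∀ s, v (2 * s) ≤ K * v s)

include hdouble

theorem le_mul_half_of_doubling (s : ℝ) : v s ≤ K * v (s / 2) := by
  simpa only [mul_div_cancel₀ s two_ne_zero] using hdouble (s / 2)

include hK hB

theorem forall_le_pow_mul_of_doubling (n : ℕ) : ∀ s, |s| ≤ 2 ^ n * δ → v s ≤ K ^ n * B := by
  induction n with
  | zero => simpa using hB
  | succ n ih =>
    intro s hs
    have hhalf := ih (s / 2) (by rw [abs_div, abs_two]; rw [pow_succ] at hs; linarith)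
    calc v s ≤ K * v (s / 2) := le_mul_half_of_doubling hdouble s
      _ ≤ K * (K ^ n * B) := by gcongr
      _ = K ^ (n + 1) * B := by ring

theorem exists_forall_le_mul_exp_of_doubling (hδ : 0 < δ) {ε : ℝ} (hε : 0 < ε) :
    ∃ C > 0, ∀ s, v s ≤ C * Real.exp (ε * |s|) := by
  -- From the scale `2 ^ k * δ` on, doubling the argument gains at least a factor `K`.
  obtain ⟨k, hk⟩ : ∃ k : ℕ, K ≤ Real.exp (ε * (2 ^ k * δ / 2)) := by
    have h := (tendsto_pow_atTop_atTop_of_one_lt (one_lt_two (α := ℝ))).atTop_mul_const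
      (by positivity : 0 < ε * δ / 2)
    obtain ⟨k, hk⟩ := ((Real.tendsto_exp_atTop.comp h).eventually_ge_atTop K).exists
    exact ⟨k, hk.trans_eq (by simp only [Function.comp_apply]; ring_nf)⟩
  set C := max (K ^ k * B) 1
  have hC : 0 < C := lt_max_of_lt_right one_pos
  have hexp (n : ℕ) : ∀ s, |s| ≤ 2 ^ n * (2 ^ k * δ) → v s ≤ C * Real.exp (ε * |s|) := by
    induction n with
    | zero =>
      intro s hs
      have hsC : v s ≤ C :=
        (forall_le_pow_mul_of_doubling hK hB hdouble k s (by simpa using hs)).trans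
          (le_max_left _ _)
      exact hsC.trans (le_mul_of_one_le_right hC.le (Real.one_le_exp (by positivity)))
    | succ n ih =>
      intro s hs
      rcases le_total |s| (2 ^ k * δ) with hsmall | hlarge
      · exact ih s (hsmall.trans (le_mul_of_one_le_left (by positivity) (one_le_pow₀ one_le_two)))
      have habs : |s / 2| = |s| / 2 := by rw [abs_div, abs_two]
      have hhalf := ih (s / 2) (by rw [habs]; rw [pow_succ] at hs; linarith)
      rw [habs] at hhalf
      calc v s ≤ K * v (s / 2) := le_mul_half_of_doubling hdouble s
        _ ≤ K * (C * Real.exp (ε * (|s| / 2))) := by gcongr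
        _ ≤ Real.exp (ε * (|s| / 2)) * (C * Real.exp (ε * (|s| / 2))) := by
            gcongr
            exact hk.trans (by gcongr)
        _ = C * Real.exp (ε * |s|) := by rw [mul_left_comm, ← Real.exp_add]; ring_nf
  refine ⟨C, hC, fun s => ?_⟩
  obtain ⟨n, hn⟩ := pow_unbounded_of_one_lt (|s| / (2 ^ k * δ)) one_lt_two
  exact hexp n s ((div_le_iff₀ (by positivity)).1 hn.le)

end Doubling

namespace StronglyAdmissible

variable {v : ℝ → ℝ} (hv : StronglyAdmissible v)

include hv

theorem pos (s : ℝ) : 0 < v s := one_pos.trans_le (hv.one_le s)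

theorem exists_one_le_subadd : ∃ M : ℝ, 1 ≤ M ∧ ∀ s t, v (s + t) ≤ M * (v s + v t) := by
  obtain ⟨M, hM⟩ := hv.subadd
  refine ⟨max M 1, le_max_right _ _, fun s t => (hM s t).trans ?_⟩
  exact mul_le_mul_of_nonneg_right (le_max_left _ _) (add_pos (hv.pos s) (hv.pos t)).le

theorem exists_forall_le_mul_exp {ε : ℝ} (hε : 0 < ε) :
    ∃ C > 0, ∀ s, v s ≤ C * Real.exp (ε * |s|) := by
  obtain ⟨M, hM, hsub⟩ := hv.exists_one_le_subadd
  obtain ⟨δ, hδ, B, hB⟩ :=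
    exists_forall_abs_le_le_of_subadd hv.measurable (zero_le_one.trans hM) hsub
  refine exists_forall_le_mul_exp_of_doubling (K := 2 * M) (by linarith) hB (fun s => ?_) hδ hε
  calc v (2 * s) = v (s + s) := by rw [two_mul]
    _ ≤ M * (v s + v s) := hsub s s
    _ = 2 * M * v s := by ring

end StronglyAdmissible

/-- The weight `s ↦ v s * e^{ω|s|}` of the space `W²_v(St_ω)`. -/
def weight (v : ℝ → ℝ) (ω s : ℝ) : ℝ := v s * Real.exp (ω * |s|)

section Weight

variable {v : ℝ → ℝ} (hv : StronglyAdmissible v) {ω : ℝ}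

theorem weighted_apply (g : ℝ → ℂ) (s : ℝ) : weighted v ω g s = (weight v ω s : ℂ) * g s := rfl

include hv

theorem measurable_weight : Measurable (weight v ω) :=
  hv.measurable.mul (by fun_prop)

theorem weight_pos (s : ℝ) : 0 < weight v ω s := mul_pos (hv.pos s) (Real.exp_pos _)

theorem one_le_weight (hω : 0 ≤ ω) (s : ℝ) : 1 ≤ weight v ω s :=
  one_le_mul_of_one_le_of_one_le (hv.one_le s) (Real.one_le_exp (by positivity))

theorem norm_weighted (g : ℝ → ℂ) (s : ℝ) : ‖weighted v ω g s‖ = weight v ω s * ‖g s‖ := by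
  rw [weighted_apply, norm_mul, Complex.norm_real, Real.norm_of_nonneg (weight_pos hv s).le]

theorem aestronglyMeasurable_weighted {g : ℝ → ℂ} (hg : AEStronglyMeasurable g) :
    AEStronglyMeasurable (weighted v ω g) :=
  (Complex.measurable_ofReal.comp (measurable_weight hv)).aestronglyMeasurable.mul hg

theorem exists_forall_weight_le_mul_exp {δ : ℝ} (hδ : ω < δ) :
    ∃ C > 0, ∀ s, weight v ω s ≤ C * Real.exp (δ * |s|) := by
  obtain ⟨C, hC, h⟩ := hv.exists_forall_le_mul_exp (sub_pos.2 hδ)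
  refine ⟨C, hC, fun s => ?_⟩
  calc weight v ω s ≤ C * Real.exp ((δ - ω) * |s|) * Real.exp (ω * |s|) :=
        mul_le_mul_of_nonneg_right (h s) (Real.exp_pos _).le
    _ = C * Real.exp (δ * |s|) := by rw [mul_assoc, ← Real.exp_add]; ring_nf

theorem exists_forall_weight_le_mul_add (hω : 0 ≤ ω) :
    ∃ M ≥ 0, ∀ s t, weight v ω (t + s) ≤
      M * (Real.exp (ω * |t|) * weight v ω s + weight v ω t * Real.exp (ω * |s|)) := by
  obtain ⟨M, hM, hsub⟩ := hv.exists_one_le_subadd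
  have hM0 : 0 ≤ M := zero_le_one.trans hM
  refine ⟨M, hM0, fun s t => ?_⟩
  have hexp : Real.exp (ω * |t + s|) ≤ Real.exp (ω * |t|) * Real.exp (ω * |s|) := by
    rw [← Real.exp_add, ← mul_add]
    gcongr
    exact abs_add_le t s
  have h0 : 0 ≤ M * (v t + v s) := mul_nonneg hM0 (add_pos (hv.pos t) (hv.pos s)).le
  calc weight v ω (t + s) ≤ (M * (v t + v s)) * (Real.exp (ω * |t|) * Real.exp (ω * |s|)) :=
        mul_le_mul (hsub t s) hexp (Real.exp_pos _).le h0
    _ = _ := by unfold weight; ring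

end Weight

/-! ### The weighted `L²`-space -/

theorem memLp_two_exp_neg_mul_abs {ε : ℝ} (hε : 0 < ε) :
    MemLp (fun s : ℝ => Real.exp (-ε * |s|)) 2 volume := by
  rw [memLp_two_iff_integrable_sq (by fun_prop)]
  have h : Integrable (fun s : ℝ => Real.exp (-(2 * ε) * |s|)) :=
    .of_integral_ne_zero (by
      rw [integral_comp_abs (f := fun s => Real.exp (-(2 * ε) * s)),
        integral_exp_mul_Ioi (by linarith)]
      simp [hε.ne'])
  refine h.congr (Eventually.of_forall fun s => ?_)
  simp only [sq, ← Real.exp_add]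
  ring_nf

section MemWeightedL2

variable {v : ℝ → ℝ} {ω : ℝ} {g : ℝ → ℂ}

theorem fourierStrip_congr_ae {h : ℝ → ℂ} (e : g =ᵐ[volume] h) :
    fourierStrip ω g = fourierStrip ω h := by
  funext z
  refine integral_congr_ae ?_
  filter_upwards [e] with s hs
  rw [hs]

variable (hv : StronglyAdmissible v)

include hv

theorem MemWeightedL2.of_memLp_weighted (hω : 0 ≤ ω) (hg : AEStronglyMeasurable g)
    (h : MemLp (weighted v ω g) 2 volume) : MemWeightedL2 v ω g := by
  refine ⟨h.mono hg (Eventually.of_forall fun s => ?_), h⟩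
  rw [norm_weighted hv]
  exact le_mul_of_one_le_left (norm_nonneg _) (one_le_weight hv hω s)

theorem MemWeightedL2.of_norm_le_exp (hω : 0 ≤ ω) (hg : AEStronglyMeasurable g) {C δ : ℝ}
    (hδ : ω < δ) (h : ∀ s, ‖g s‖ ≤ C * Real.exp (-δ * |s|)) : MemWeightedL2 v ω g := by
  obtain ⟨γ, hωγ, hγδ⟩ := exists_between hδ
  obtain ⟨K, hK, hw⟩ := exists_forall_weight_le_mul_exp hv hωγ
  refine .of_memLp_weighted hv hω hg (((memLp_two_exp_neg_mul_abs (sub_pos.2 hγδ)).const_mul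
    (K * C)).mono (aestronglyMeasurable_weighted hv hg) (Eventually.of_forall fun s => ?_))
  refine le_trans ?_ (le_abs_self _)
  calc ‖weighted v ω g s‖ = weight v ω s * ‖g s‖ := norm_weighted hv g s
    _ ≤ (K * Real.exp (γ * |s|)) * (C * Real.exp (-δ * |s|)) :=
        mul_le_mul (hw s) (h s) (norm_nonneg _) (by positivity)
    _ = K * C * (Real.exp (γ * |s|) * Real.exp (-δ * |s|)) := by ring
    _ = K * C * Real.exp (-(δ - γ) * |s|) := by rw [← Real.exp_add]; ring_nf

theorem MemWeightedL2.integrable_exp_mul (hg : MemWeightedL2 v ω g) :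
    Integrable (fun s => ((Real.exp (ω * |s|) : ℝ) : ℂ) * g s) := by
  refine (hv.inv_memLp.ofReal.integrable_mul (𝕜 := ℂ) hg.2).congr (Eventually.of_forall fun s => ?_)
  have hne : (v s : ℂ) ≠ 0 := Complex.ofReal_ne_zero.2 (hv.pos s).ne'
  change ((1 / v s : ℝ) : ℂ) * (((v s * Real.exp (ω * |s|) : ℝ) : ℂ) * g s) = _
  push_cast
  field_simp

theorem MemWeightedL2.integrable (hω : 0 ≤ ω) (hg : MemWeightedL2 v ω g) : Integrable g := by
  refine (hg.integrable_exp_mul hv).mono hg.1.1 (Eventually.of_forall fun s => ?_)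
  rw [norm_mul, Complex.norm_real, Real.norm_of_nonneg (Real.exp_pos _).le]
  exact le_mul_of_one_le_left (norm_nonneg _) (Real.one_le_exp (by positivity))

end MemWeightedL2

/-! ### Products -/

section Young

variable {G : Type*} [AddCommGroup G] [MeasurableSpace G] [MeasurableAdd₂ G] [MeasurableNeg G]
  {μ : Measure G} [μ.IsAddLeftInvariant]

theorem aemeasurable_comp_neg_add [μ.IsNegInvariant] {b : G → ℝ≥0∞}
    (hb : AEMeasurable b μ) (x : G) :
    AEMeasurable (fun y => b (-y + x)) μ := by
  simpa only [neg_add_eq_sub, Function.comp_def] using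
    hb.comp_quasiMeasurePreserving (Measure.measurePreserving_sub_left μ x).quasiMeasurePreserving

theorem lconvolution_rpow_le [μ.IsNegInvariant] {p q : ℝ} (hpq : p.HolderConjugate q)
    {a b : G → ℝ≥0∞} (ha : AEMeasurable a μ) (hb : AEMeasurable b μ) (x : G) :
    (a ⋆ₗ[μ] b) x ^ p ≤ (∫⁻ y, a y ∂μ) ^ (p / q) * (a ⋆ₗ[μ] fun y => b y ^ p) x := by
  have hp := hpq.pos
  have hq := hpq.symm.pos
  have hbx := aemeasurable_comp_neg_add hb x
  have hsplit (y : G) :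
      a y ^ (1 / q) * (a y ^ (1 / p) * b (-y + x)) = a y * b (-y + x) := by
    rw [← mul_assoc, ← ENNReal.rpow_add_of_nonneg _ _ (by positivity) (by positivity), add_comm,
      one_div, one_div, hpq.inv_add_inv_eq_one, ENNReal.rpow_one]
  have hpow_q (y : G) : (a y ^ (1 / q)) ^ q = a y := by
    rw [← ENNReal.rpow_mul, one_div_mul_cancel hq.ne', ENNReal.rpow_one]
  have hpow_p (y : G) : (a y ^ (1 / p) * b (-y + x)) ^ p = a y * b (-y + x) ^ p := by
    rw [ENNReal.mul_rpow_of_nonneg _ _ hp.le, ← ENNReal.rpow_mul, one_div_mul_cancel hp.ne',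
      ENNReal.rpow_one]
  have hHolder := ENNReal.lintegral_mul_le_Lp_mul_Lq μ hpq.symm (ha.pow_const (1 / q))
    ((ha.pow_const (1 / p)).mul hbx)
  simp only [Pi.mul_apply, hsplit, hpow_q, hpow_p] at hHolder
  calc (a ⋆ₗ[μ] b) x ^ p
      ≤ ((∫⁻ y, a y ∂μ) ^ (1 / q) * (∫⁻ y, a y * b (-y + x) ^ p ∂μ) ^ (1 / p)) ^ p :=
        ENNReal.rpow_le_rpow hHolder hp.le
    _ = _ := by
        rw [ENNReal.mul_rpow_of_nonneg _ _ hp.le, ← ENNReal.rpow_mul, ← ENNReal.rpow_mul,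
          one_div_mul_cancel hp.ne', ENNReal.rpow_one, one_div_mul_eq_div, lconvolution_def]

variable [SFinite μ]

theorem lintegral_lconvolution {a b : G → ℝ≥0∞} (ha : AEMeasurable a μ) (hb : AEMeasurable b μ) :
    ∫⁻ x, (a ⋆ₗ[μ] b) x ∂μ = (∫⁻ y, a y ∂μ) * ∫⁻ y, b y ∂μ := by
  simp only [lconvolution_def]
  rw [lintegral_lintegral_swap (by fun_prop), ← lintegral_mul_const'' _ ha]
  refine lintegral_congr fun y => ?_
  have hby : AEMeasurable (fun x => b (-y + x)) μ := hb.comp_quasiMeasurePreserving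
    (measurePreserving_add_left μ (-y)).quasiMeasurePreserving
  rw [lintegral_const_mul'' _ hby, lintegral_add_left_eq_self]

variable [μ.IsNegInvariant]

theorem lintegral_lconvolution_rpow_le {p q : ℝ} (hpq : p.HolderConjugate q) {a b : G → ℝ≥0∞}
    (ha : AEMeasurable a μ) (hb : AEMeasurable b μ) :
    ∫⁻ x, (a ⋆ₗ[μ] b) x ^ p ∂μ ≤ (∫⁻ y, a y ∂μ) ^ p * ∫⁻ y, b y ^ p ∂μ := by
  have hexp : p / q + 1 = p := by
    rw [div_eq_mul_inv, ← hpq.one_sub_inv, mul_sub, mul_inv_cancel₀ hpq.ne_zero]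
    ring
  have hbp : AEMeasurable (fun y => b y ^ p) μ := hb.pow_const p
  calc ∫⁻ x, (a ⋆ₗ[μ] b) x ^ p ∂μ
      ≤ ∫⁻ x, (∫⁻ y, a y ∂μ) ^ (p / q) * (a ⋆ₗ[μ] fun y => b y ^ p) x ∂μ :=
        lintegral_mono (lconvolution_rpow_le hpq ha hb)
    _ = (∫⁻ y, a y ∂μ) ^ (p / q) * ((∫⁻ y, a y ∂μ) * ∫⁻ y, b y ^ p ∂μ) := by
        rw [lintegral_const_mul'' _ (aemeasurable_lconvolution ha hbp),
          lintegral_lconvolution ha hbp]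
    _ = (∫⁻ y, a y ∂μ) ^ p * ∫⁻ y, b y ^ p ∂μ := by
        have hpq0 : 0 ≤ p / q := (div_pos hpq.pos hpq.symm.pos).le
        nth_rw 2 [← ENNReal.rpow_one (∫⁻ y, a y ∂μ)]
        rw [← mul_assoc, ← ENNReal.rpow_add_of_nonneg _ _ hpq0 zero_le_one, hexp]

theorem memLp_lconvolution {p q : ℝ} (hpq : p.HolderConjugate q) {a b : G → ℝ≥0∞}
    (ha : AEMeasurable a μ) (ha_fin : ∫⁻ y, a y ∂μ ≠ ∞) (hb : AEMeasurable b μ)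
    (hb_fin : ∫⁻ y, b y ^ p ∂μ ≠ ∞) :
    MemLp (a ⋆ₗ[μ] b) (ENNReal.ofReal p) μ := by
  refine ⟨(aemeasurable_lconvolution ha hb).aestronglyMeasurable, ?_⟩
  have hp := hpq.pos
  rw [eLpNorm_lt_top_iff_lintegral_rpow_enorm_lt_top (by simpa using hp) ENNReal.ofReal_ne_top,
    ENNReal.toReal_ofReal hp.le]
  exact (lintegral_lconvolution_rpow_le hpq ha hb).trans_lt
    (ENNReal.mul_lt_top (ENNReal.rpow_lt_top_of_nonneg hp.le ha_fin) hb_fin.lt_top)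

end Young

section Products

open scoped Convolution

variable {v : ℝ → ℝ} (hv : StronglyAdmissible v) {ω : ℝ} (hω : 0 ≤ ω) {g h : ℝ → ℂ}

include hv

theorem memLp_two_lconvolution (hg : MemWeightedL2 v ω g) (hh : MemWeightedL2 v ω h) :
    MemLp ((fun s => ‖((Real.exp (ω * |s|) : ℝ) : ℂ) * g s‖ₑ) ⋆ₗ fun s => ‖weighted v ω h s‖ₑ)
      2 volume := by
  rw [← ENNReal.ofReal_ofNat 2]
  refine memLp_lconvolution Real.HolderConjugate.two_two (hg.integrable_exp_mul hv).1.enorm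
    (hg.integrable_exp_mul hv).2.ne hh.2.1.enorm ?_
  have := (eLpNorm_lt_top_iff_lintegral_rpow_enorm_lt_top two_ne_zero ENNReal.ofNat_ne_top).1 hh.2.2
  exact (by simpa using this : _ < ∞).ne

include hω

theorem exists_forall_enorm_weighted_convolution_le :
    ∃ M : ℝ≥0, ∀ g h : ℝ → ℂ, MemWeightedL2 v ω g → MemWeightedL2 v ω h → ∀ s,
      ‖weighted v ω (g ⋆[ContinuousLinearMap.mul ℝ ℂ] h) s‖ₑ ≤ M *
        (((fun s => ‖((Real.exp (ω * |s|) : ℝ) : ℂ) * g s‖ₑ) ⋆ₗ fun s => ‖weighted v ω h s‖ₑ) s +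
          ((fun s => ‖weighted v ω g s‖ₑ) ⋆ₗ
            fun s => ‖((Real.exp (ω * |s|) : ℝ) : ℂ) * h s‖ₑ) s) := by
  obtain ⟨M, hM, hw⟩ := exists_forall_weight_le_mul_add hv hω
  lift M to ℝ≥0 using hM
  refine ⟨M, fun g h hg hh s => ?_⟩
  set e : (ℝ → ℂ) → ℝ → ℂ := fun g s => ((Real.exp (ω * |s|) : ℝ) : ℂ) * g s
  have hpoint (t : ℝ) : ‖(weight v ω s : ℂ) * (g t * h (s - t))‖ₑ ≤ M *
      (‖e g t‖ₑ * ‖weighted v ω h (-t + s)‖ₑ + ‖weighted v ω g t‖ₑ * ‖e h (-t + s)‖ₑ) := by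
    have hwt := hw (s - t) t
    rw [add_sub_cancel] at hwt
    simp only [← enorm_mul, neg_add_eq_sub]
    simp only [enorm_eq_nnnorm, ← ENNReal.coe_add, ← ENNReal.coe_mul, ENNReal.coe_le_coe,
      ← NNReal.coe_le_coe, NNReal.coe_mul, NNReal.coe_add, coe_nnnorm, e, norm_mul,
      norm_weighted hv, Complex.norm_real, Real.norm_of_nonneg (Real.exp_pos _).le,
      Real.norm_of_nonneg (weight_pos hv _).le]
    calc weight v ω s * (‖g t‖ * ‖h (s - t)‖) ≤ _ :=
          mul_le_mul_of_nonneg_right hwt (by positivity)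
      _ = _ := by ring
  calc ‖weighted v ω (g ⋆[ContinuousLinearMap.mul ℝ ℂ] h) s‖ₑ
      = ‖∫ t, (weight v ω s : ℂ) * (g t * h (s - t))‖ₑ := by
        rw [weighted_apply, convolution_def, integral_const_mul]; rfl
    _ ≤ ∫⁻ t, ‖(weight v ω s : ℂ) * (g t * h (s - t))‖ₑ := enorm_integral_le_lintegral_enorm _
    _ ≤ _ := lintegral_mono hpoint
    _ = _ := by
        have hmeas : AEMeasurable fun t => ‖e g t‖ₑ * ‖weighted v ω h (-t + s)‖ₑ :=
          (hg.integrable_exp_mul hv).1.enorm.mul (aemeasurable_comp_neg_add hh.2.1.enorm s)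
        rw [lintegral_const_mul' _ _ ENNReal.coe_ne_top, lintegral_add_left' hmeas]
        rfl

theorem MemWeightedL2.convolution (hg : MemWeightedL2 v ω g) (hh : MemWeightedL2 v ω h) :
    MemWeightedL2 v ω (g ⋆[ContinuousLinearMap.mul ℝ ℂ] h) := by
  have hmeas : AEStronglyMeasurable (g ⋆[ContinuousLinearMap.mul ℝ ℂ] h) :=
    ((hg.integrable hv hω).integrable_convolution _ (hh.integrable hv hω)).1
  obtain ⟨M, hM⟩ := exists_forall_enorm_weighted_convolution_le hv hω
  have hsymm := memLp_two_lconvolution hv hh hg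
  rw [lconvolution_comm] at hsymm
  have hweighted := ((memLp_two_lconvolution hv hg hh).add hsymm).of_enorm_le_mul
    (aestronglyMeasurable_weighted hv hmeas) (Eventually.of_forall (hM g h hg hh))
  exact .of_memLp_weighted hv hω hmeas hweighted

omit hω in
theorem fourierStrip_convolution (hg : MemWeightedL2 v ω g) (hh : MemWeightedL2 v ω h) :
    fourierStrip ω (g ⋆[ContinuousLinearMap.mul ℝ ℂ] h) = fourierStrip ω g * fourierStrip ω h := by
  funext z
  have hprod := integral_convolution (μ := (volume : Measure ℝ)) (ν := volume)
    (ContinuousLinearMap.mul ℝ ℂ) (integrable_fourierStrip hv hg z)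
    (integrable_fourierStrip hv hh z)
  refine Eq.trans ?_ hprod
  refine integral_congr_ae (Eventually.of_forall fun s => ?_)
  simp only [convolution_def, ContinuousLinearMap.mul_apply', ← integral_const_mul]
  refine integral_congr_ae (Eventually.of_forall fun t => ?_)
  have hexp : Complex.exp (-Complex.I * s * z) =
      Complex.exp (-Complex.I * t * z) * Complex.exp (-Complex.I * (s - t : ℝ) * z) := by
    rw [← Complex.exp_add]; push_cast; ring_nf
  simp only [hexp]
  ring

theorem mul_mem_sobolevSpace {f₁ f₂ : strip ω → ℂ} (h₁ : f₁ ∈ sobolevSpace hv ω)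
    (h₂ : f₂ ∈ sobolevSpace hv ω) : f₁ * f₂ ∈ sobolevSpace hv ω := by
  obtain ⟨g, hg, rfl⟩ := h₁
  obtain ⟨h, hh, rfl⟩ := h₂
  exact ⟨_, hg.convolution hv hω hh, (fourierStrip_convolution hv hg hh).symm⟩

end Products

/-! ### The Cauchy formula on strips -/

section HorizontalLines

theorem hasDerivAt_half_log_add_arctan {p : ℝ} (hp : p ≠ 0) (x : ℝ) :
    HasDerivAt (fun x : ℝ => ((1 / 2 * Real.log (x ^ 2 + p ^ 2) : ℝ) : ℂ) -
      (Real.arctan (x / p) : ℂ) * Complex.I) ((x : ℂ) + p * Complex.I)⁻¹ x := by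
  have hpos : 0 < x ^ 2 + p ^ 2 := by positivity
  have hlog : HasDerivAt (fun x : ℝ => 1 / 2 * Real.log (x ^ 2 + p ^ 2)) (x / (x ^ 2 + p ^ 2)) x :=
    ((((hasDerivAt_pow 2 x).add_const (p ^ 2)).log hpos.ne').const_mul (1 / 2)).congr_deriv
      (by push_cast; ring)
  have harctan : HasDerivAt (fun x : ℝ => Real.arctan (x / p)) (p / (x ^ 2 + p ^ 2)) x :=
    ((hasDerivAt_id x).div_const p).arctan.congr_deriv (by simp only [id]; field_simp; ring)
  refine (hlog.ofReal_comp.sub (harctan.ofReal_comp.mul_const Complex.I)).congr_deriv ?_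
  have hne : (x : ℂ) ^ 2 + p ^ 2 ≠ 0 := by exact_mod_cast hpos.ne'
  refine eq_inv_of_mul_eq_one_left ?_
  push_cast
  field_simp
  linear_combination -(p : ℂ) ^ 2 * Complex.I_sq

theorem add_mul_I_ne_zero {p : ℝ} (hp : p ≠ 0) (x : ℝ) : (x : ℂ) + p * Complex.I ≠ 0 :=
  fun h => hp (by simpa using congrArg Complex.im h)

theorem continuous_inv_add_mul_I {p : ℝ} (hp : p ≠ 0) :
    Continuous fun x : ℝ => ((x : ℂ) + p * Complex.I)⁻¹ :=
  .inv₀ (by fun_prop) (add_mul_I_ne_zero hp)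

theorem integral_inv_add_mul_I {p : ℝ} (hp : p ≠ 0) (R : ℝ) :
    ∫ x in -R..R, ((x : ℂ) + p * Complex.I)⁻¹ = -(2 * Real.arctan (R / p)) * Complex.I := by
  rw [intervalIntegral.integral_eq_sub_of_hasDerivAt
    (fun x _ => hasDerivAt_half_log_add_arctan hp x)
    ((continuous_inv_add_mul_I hp).intervalIntegrable _ _)]
  simp only [neg_sq, neg_div, Real.arctan_neg]
  push_cast
  ring

theorem tendsto_integral_inv_add_mul_I_of_pos {p : ℝ} (hp : 0 < p) :
    Tendsto (fun R => ∫ x in -R..R, ((x : ℂ) + p * Complex.I)⁻¹) atTop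
      (𝓝 (-(Real.pi * Complex.I))) := by
  have harctan : Tendsto (fun R => Real.arctan (R / p)) atTop (𝓝 (Real.pi / 2)) :=
    (tendsto_nhds_of_tendsto_nhdsWithin Real.tendsto_arctan_atTop).comp
      (tendsto_id.atTop_div_const hp)
  simp only [integral_inv_add_mul_I hp.ne']
  convert ((harctan.ofReal.const_mul 2).neg.mul_const Complex.I) using 2
  push_cast
  ring

theorem tendsto_integral_inv_add_mul_I_of_neg {p : ℝ} (hp : p < 0) :
    Tendsto (fun R => ∫ x in -R..R, ((x : ℂ) + p * Complex.I)⁻¹) atTop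
      (𝓝 (Real.pi * Complex.I)) := by
  have h := (tendsto_integral_inv_add_mul_I_of_pos (neg_pos.2 hp)).neg
  simp only [integral_inv_add_mul_I hp.ne, integral_inv_add_mul_I (neg_ne_zero.2 hp.ne), div_neg,
    Real.arctan_neg, neg_neg] at h ⊢
  simpa using h

variable {E : Type*} [NormedAddCommGroup E] [NormedSpace ℂ E]

theorem tendsto_integral_vertical_of_norm_le_div {g : ℂ → E} {p q C : ℝ} (hpq : p ≤ q)
    (hC : ∀ w : ℂ, w.im ∈ Set.Icc p q → w.re ≠ 0 → ‖g w‖ ≤ C / |w.re|) {l : Filter ℝ}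
    (hl : Tendsto (|·|) l atTop) :
    Tendsto (fun R : ℝ => ∫ y in p..q, g (R + y * Complex.I)) l (𝓝 0) := by
  have hlim : Tendsto (fun R : ℝ => C / |R| * |q - p|) l (𝓝 0) := by
    simpa using (hl.const_div_atTop C).mul_const |q - p|
  refine squeeze_zero_norm' ?_ hlim
  filter_upwards [hl.eventually_gt_atTop 0] with R hR
  refine intervalIntegral.norm_integral_le_of_norm_le_const fun y hy => ?_
  rw [Set.uIoc_of_le hpq] at hy
  simpa using hC (R + y * Complex.I) (by simpa using Set.Ioc_subset_Icc_self hy)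
    (by simpa using hR)

theorem integrable_inv_add_mul_I_smul {u : ℝ → E} {r : ℝ} (hr : r ≠ 0) (hu : Integrable u) :
    Integrable fun x : ℝ => ((x : ℂ) + r * Complex.I)⁻¹ • u x := by
  refine hu.bdd_smul |r|⁻¹ (continuous_inv_add_mul_I hr).aestronglyMeasurable
    (Eventually.of_forall fun x => ?_)
  rw [norm_inv]
  exact inv_anti₀ (abs_pos.2 hr) (by simpa using Complex.abs_im_le_norm (x + r * Complex.I))

theorem dslope_zero_of_ne {φ : ℂ → E} {w : ℂ} (hw : w ≠ 0) :
    dslope φ 0 w = w⁻¹ • φ w - w⁻¹ • φ 0 := by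
  rw [dslope_of_ne _ hw, slope_def_module, sub_zero, smul_sub]

theorem norm_dslope_zero_le_div {φ : ℂ → E} {C : ℝ} {w : ℂ} (h0 : ‖φ 0‖ ≤ C) (hw : ‖φ w‖ ≤ C)
    (hre : w.re ≠ 0) : ‖dslope φ 0 w‖ ≤ (C + C) / |w.re| := by
  have hsub : ‖φ w - φ 0‖ ≤ C + C := norm_sub_le_of_le hw h0
  rw [dslope_zero_of_ne (fun h => hre (by simp [h])), ← smul_sub, norm_smul, norm_inv,
    inv_mul_eq_div]
  gcongr
  · exact (norm_nonneg _).trans hsub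
  · exact Complex.abs_re_le_norm w

theorem tendsto_integral_sub_integral_of_norm_le_div {g : ℂ → E} {p q C : ℝ} (hpq : p ≤ q)
    (hg : DifferentiableOn ℂ g (Complex.im ⁻¹' Set.Icc p q))
    (hC : ∀ w : ℂ, w.im ∈ Set.Icc p q → w.re ≠ 0 → ‖g w‖ ≤ C / |w.re|) :
    Tendsto (fun R : ℝ => (∫ x in -R..R, g (x + p * Complex.I)) -
      ∫ x in -R..R, g (x + q * Complex.I)) atTop (𝓝 0) := by
  have hright := tendsto_integral_vertical_of_norm_le_div hpq hC tendsto_abs_atTop_atTop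
  have hleft := (tendsto_integral_vertical_of_norm_le_div hpq hC tendsto_abs_atBot_atTop).comp
    tendsto_neg_atTop_atBot
  have hsides := (hleft.const_smul Complex.I).sub (hright.const_smul Complex.I)
  rw [smul_zero, sub_zero] at hsides
  refine hsides.congr fun R => ?_
  have hrect := Complex.integral_boundary_rect_eq_zero_of_differentiableOn g ⟨-R, p⟩ ⟨R, q⟩
    (hg.mono fun w hw => by simpa [Set.uIcc_of_le hpq] using hw.2)
  simp only at hrect
  simp only [Function.comp_apply]
  exact sub_eq_iff_eq_add.2 (sub_eq_zero.1 hrect).symm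

variable [CompleteSpace E]

theorem tendsto_integral_dslope_zero {φ : ℂ → E} {r : ℝ} {c : ℂ} (hr : r ≠ 0)
    (hφ : Integrable fun x : ℝ => φ (x + r * Complex.I))
    (hc : Tendsto (fun R : ℝ => ∫ x in -R..R, ((x : ℂ) + r * Complex.I)⁻¹) atTop (𝓝 c)) :
    Tendsto (fun R : ℝ => ∫ x in -R..R, dslope φ 0 (x + r * Complex.I)) atTop
      (𝓝 ((∫ x : ℝ, ((x : ℂ) + r * Complex.I)⁻¹ • φ (x + r * Complex.I)) - c • φ 0)) := by
  have hint := integrable_inv_add_mul_I_smul hr hφ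
  refine ((intervalIntegral_tendsto_integral hint tendsto_neg_atTop_atBot tendsto_id).sub
    (hc.smul_const (φ 0))).congr fun R => ?_
  simp only [dslope_zero_of_ne (add_mul_I_ne_zero hr _)]
  have hconst : Continuous fun x : ℝ => ((x : ℂ) + r * Complex.I)⁻¹ • φ 0 :=
    (continuous_inv_add_mul_I hr).smul continuous_const
  rw [intervalIntegral.integral_sub hint.intervalIntegrable (hconst.intervalIntegrable _ _),
    intervalIntegral.integral_smul_const, id]

-- The integrals of `(φ w - φ 0) / w` over both lines agree, and those of `1 / w` differ by `2πi`.
theorem integral_inv_smul_sub_integral_inv_smul {φ : ℂ → E} {p q C : ℝ} (hp : p < 0) (hq : 0 < q)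
    (hφ : DifferentiableOn ℂ φ (Complex.im ⁻¹' Set.Icc p q))
    (hC : ∀ w : ℂ, w.im ∈ Set.Icc p q → ‖φ w‖ ≤ C)
    (hφp : Integrable fun x : ℝ => φ (x + p * Complex.I))
    (hφq : Integrable fun x : ℝ => φ (x + q * Complex.I)) :
    (∫ x : ℝ, ((x : ℂ) + p * Complex.I)⁻¹ • φ (x + p * Complex.I)) -
      ∫ x : ℝ, ((x : ℂ) + q * Complex.I)⁻¹ • φ (x + q * Complex.I) =
      (2 * Real.pi * Complex.I) • φ 0 := by
  have hnhds : Complex.im ⁻¹' Set.Icc p q ∈ 𝓝 (0 : ℂ) :=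
    Complex.continuous_im.continuousAt.preimage_mem_nhds (by simpa using Icc_mem_nhds hp hq)
  have h0 : ‖φ 0‖ ≤ C := hC 0 (by simp [hp.le, hq.le])
  have hcauchy := tendsto_integral_sub_integral_of_norm_le_div (hp.trans hq).le
    ((Complex.differentiableOn_dslope hnhds).2 hφ)
    fun w hw => norm_dslope_zero_le_div h0 (hC w hw)
  have hlim := tendsto_nhds_unique hcauchy
    ((tendsto_integral_dslope_zero hp.ne hφp (tendsto_integral_inv_add_mul_I_of_neg hp)).sub
      (tendsto_integral_dslope_zero hq.ne' hφq (tendsto_integral_inv_add_mul_I_of_pos hq)))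
  rw [sub_sub_sub_comm, eq_comm, sub_eq_zero, ← sub_smul] at hlim
  rw [hlim]
  ring_nf

end HorizontalLines

section Elementary

variable {θ : ℝ} {ψ : ℂ → ℂ}

theorem integrable_of_mem_elementary (hψ : ψ ∈ elementary θ) {r : ℝ} (hr : |r| < θ) :
    Integrable fun s : ℝ => ψ (s + r * Complex.I) := by
  have hcont : Continuous fun s : ℝ => ψ (s + r * Complex.I) :=
    hψ.1.continuousOn.comp_continuous (by fun_prop) fun s => by simpa [openStrip] using hr
  exact ⟨hcont.aestronglyMeasurable, (le_iSup₂ (f := fun (r : ℝ) (_ : |r| < θ) =>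
    ∫⁻ s : ℝ, ‖ψ (s + r * Complex.I)‖ₑ) r hr).trans_lt hψ.2.2⟩

theorem cauchy_formula_of_mem_elementary (hψ : ψ ∈ elementary θ) {δ : ℝ} (hδ : δ < θ) {z : ℂ}
    (hz : |z.im| < δ) :
    (∫ s : ℝ, ψ (s + (-δ : ℝ) * Complex.I) * (s + (-δ : ℝ) * Complex.I - z)⁻¹) -
      ∫ s : ℝ, ψ (s + δ * Complex.I) * (s + δ * Complex.I - z)⁻¹ =
    2 * Real.pi * Complex.I * ψ z := by
  obtain ⟨hz₁, hz₂⟩ := abs_lt.1 hz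
  obtain ⟨C, hC⟩ := hψ.2.1
  have hmem (w : ℂ) (hw : w.im ∈ Set.Icc (-δ - z.im) (δ - z.im)) : z + w ∈ openStrip θ := by
    refine (abs_le.2 ⟨?_, ?_⟩).trans_lt hδ
    · simpa [sub_le_iff_le_add, add_comm] using hw.1
    · simpa [le_sub_iff_add_le'] using hw.2
  have hshift (r x : ℝ) :
      z + (x + ((r - z.im : ℝ) : ℂ) * Complex.I) = ((x + z.re : ℝ) : ℂ) + r * Complex.I := by
    apply Complex.ext <;> simp [add_comm]
  have hint (r : ℝ) (hr : |r| < θ) :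
      Integrable fun x : ℝ => ψ (z + (x + ((r - z.im : ℝ) : ℂ) * Complex.I)) := by
    simp only [hshift]
    exact (integrable_of_mem_elementary hψ hr).comp_add_right z.re
  have htranslate (r : ℝ) : ∫ x : ℝ, ((x : ℂ) + ((r - z.im : ℝ) : ℂ) * Complex.I)⁻¹ •
      ψ (z + (x + ((r - z.im : ℝ) : ℂ) * Complex.I)) =
      ∫ s : ℝ, ψ (s + r * Complex.I) * (s + r * Complex.I - z)⁻¹ := by
    rw [← integral_add_right_eq_self
      (fun s : ℝ => ψ (s + r * Complex.I) * (s + r * Complex.I - z)⁻¹) z.re]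
    refine integral_congr_ae (Eventually.of_forall fun x => ?_)
    have hw := hshift r x
    simp only [smul_eq_mul]
    rw [hw, ← eq_sub_iff_add_eq'.2 hw, mul_comm]
  have hδ₀ : |δ| < θ := by rwa [abs_of_pos ((abs_nonneg _).trans_lt hz)]
  have h := integral_inv_smul_sub_integral_inv_smul (φ := fun w => ψ (z + w)) (by linarith)
    (by linarith) (hψ.1.comp (by fun_prop) hmem) (fun w hw => hC _ (hmem w hw))
    (hint (-δ) (by rwa [abs_neg])) (hint δ hδ₀)
  rwa [htranslate, htranslate, add_zero] at h

end Elementary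

/-! ### The Sobolev space as an image of `L²(ℝ)` -/

theorem norm_exp_neg_I_mul_le {ω : ℝ} (z : strip ω) (s : ℝ) :
    ‖Complex.exp (-Complex.I * s * (z : ℂ))‖ ≤ Real.exp (ω * |s|) := by
  rw [Complex.norm_exp, Real.exp_le_exp]
  calc (-Complex.I * s * (z : ℂ)).re = (z : ℂ).im * s := by simp [mul_comm]
    _ ≤ |(z : ℂ).im| * |s| := (le_abs_self _).trans_eq (abs_mul _ _)
    _ ≤ ω * |s| := mul_le_mul_of_nonneg_right (abs_im_le_of_mem_strip z.2) (abs_nonneg s)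

/-- Division by the weight `v(s) e^{ω|s|}`, the inverse of `weighted v ω`. -/
def unweighted (v : ℝ → ℝ) (ω : ℝ) (h : ℝ → ℂ) : ℝ → ℂ :=
  fun s => ((weight v ω s)⁻¹ : ℂ) * h s

section SobolevOfL2

variable {v : ℝ → ℝ} {ω : ℝ}

theorem unweighted_add (h k : ℝ → ℂ) :
    unweighted v ω (h + k) = unweighted v ω h + unweighted v ω k :=
  funext fun _ => mul_add _ _ _

theorem unweighted_const_smul (c : ℂ) (h : ℝ → ℂ) :
    unweighted v ω (c • h) = c • unweighted v ω h :=
  funext fun _ => mul_left_comm _ _ _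

theorem unweighted_congr_ae {h k : ℝ → ℂ} (e : h =ᵐ[volume] k) :
    unweighted v ω h =ᵐ[volume] unweighted v ω k :=
  e.mono fun s hs => by rw [unweighted, unweighted, hs]

theorem fourierStrip_const_smul (c : ℂ) (g : ℝ → ℂ) :
    fourierStrip ω (c • g) = c • fourierStrip ω g := by
  funext z
  simp only [fourierStrip, Pi.smul_apply, smul_eq_mul, mul_left_comm _ c, integral_const_mul]

variable (hv : StronglyAdmissible v)

include hv

theorem fourierStrip_add {g h : ℝ → ℂ} (hg : MemWeightedL2 v ω g) (hh : MemWeightedL2 v ω h) :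
    fourierStrip ω (g + h) = fourierStrip ω g + fourierStrip ω h := by
  funext z
  simp only [fourierStrip, Pi.add_apply, mul_add]
  exact integral_add (integrable_fourierStrip hv hg z) (integrable_fourierStrip hv hh z)

theorem ofReal_weight_ne_zero (s : ℝ) : (weight v ω s : ℂ) ≠ 0 :=
  Complex.ofReal_ne_zero.2 (weight_pos hv s).ne'

theorem weighted_unweighted (h : ℝ → ℂ) : weighted v ω (unweighted v ω h) = h :=
  funext fun s => mul_inv_cancel_left₀ (ofReal_weight_ne_zero hv s) (h s)

theorem unweighted_weighted (g : ℝ → ℂ) : unweighted v ω (weighted v ω g) = g :=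
  funext fun s => inv_mul_cancel_left₀ (ofReal_weight_ne_zero hv s) (g s)

theorem memWeightedL2_unweighted (hω : 0 ≤ ω) {h : ℝ → ℂ} (hh : MemLp h 2 volume) :
    MemWeightedL2 v ω (unweighted v ω h) := by
  have hweight := measurable_weight hv (ω := ω)
  have hinv : Measurable fun s => ((weight v ω s)⁻¹ : ℂ) := by fun_prop
  exact .of_memLp_weighted hv hω (hinv.aestronglyMeasurable.mul hh.1)
    (by rwa [weighted_unweighted hv])

/-- The parametrization of `W²_v(St_ω)` by `L²(ℝ)`, which maps `h` to the transform of
`h / (v e^{ω|·|})`. It carries Bochner integrals and dense sets of `L²(ℝ)` over to `W²_v(St_ω)`. -/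
def sobolevOfL2 (hω : 0 ≤ ω) : Lp ℂ 2 (volume : Measure ℝ) →ₗ[ℂ] sobolevSpace hv ω where
  toFun h :=
    ⟨fourierStrip ω (unweighted v ω h), _, memWeightedL2_unweighted hv hω (Lp.memLp h), rfl⟩
  map_add' h k := by
    refine Subtype.ext ((fourierStrip_congr_ae (unweighted_congr_ae (Lp.coeFn_add h k))).trans ?_)
    rw [unweighted_add]
    exact fourierStrip_add hv (memWeightedL2_unweighted hv hω (Lp.memLp h))
      (memWeightedL2_unweighted hv hω (Lp.memLp k))
  map_smul' c h := by
    refine Subtype.ext ((fourierStrip_congr_ae (unweighted_congr_ae (Lp.coeFn_smul c h))).trans ?_)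
    rw [unweighted_const_smul]
    exact fourierStrip_const_smul c _

theorem sobolevOfL2_toLp (hω : 0 ≤ ω) {g : ℝ → ℂ} (hg : MemWeightedL2 v ω g) :
    (sobolevOfL2 hv hω (hg.2.toLp _) : strip ω → ℂ) = fourierStrip ω g :=
  (fourierStrip_congr_ae (unweighted_congr_ae hg.2.coeFn_toLp)).trans
    (by rw [unweighted_weighted hv])

theorem sobolevOfL2_surjective (hω : 0 ≤ ω) : Function.Surjective (sobolevOfL2 hv hω) := by
  rintro ⟨_, g, hg, rfl⟩
  exact ⟨hg.2.toLp _, Subtype.ext (sobolevOfL2_toLp hv hω hg)⟩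

theorem sobolevNorm_sobolevOfL2_le (hω : 0 ≤ ω) (h : Lp ℂ 2 (volume : Measure ℝ)) :
    sobolevNorm v ω (sobolevOfL2 hv hω h) ≤ ‖h‖ₑ := by
  refine (iInf₂_le (unweighted v ω h)
    ⟨memWeightedL2_unweighted hv hω (Lp.memLp h), rfl⟩).trans ?_
  rw [weighted_unweighted hv, Lp.enorm_def]

theorem mem_sobolevSpace_of_sobolevNorm_lt_top {f : strip ω → ℂ} (hf : sobolevNorm v ω f < ∞) :
    f ∈ sobolevSpace hv ω := by
  simp only [sobolevNorm, iInf_lt_iff] at hf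
  obtain ⟨g, hg, -⟩ := hf
  exact ⟨g, hg⟩

theorem exists_clm_eq_sobolevOfL2_apply (hω : 0 ≤ ω) (z : strip ω) :
    ∃ ev : Lp ℂ 2 (volume : Measure ℝ) →L[ℂ] ℂ,
      ∀ h, ev h = (sobolevOfL2 hv hω h : strip ω → ℂ) z := by
  -- Evaluation at `z` is the inner product with `k(s) = conj (e^{-isz} / (v(s) e^{ω|s|}))`.
  let k : ℝ → ℂ := fun s =>
    starRingEnd ℂ (Complex.exp (-Complex.I * s * (z : ℂ)) * ((weight v ω s)⁻¹ : ℂ))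
  have hweight := measurable_weight hv (ω := ω)
  have hk : MemLp k 2 volume := by
    refine hv.inv_memLp.mono (Complex.continuous_conj.measurable.comp
      (by fun_prop)).aestronglyMeasurable (Eventually.of_forall fun s => ?_)
    rw [RCLike.norm_conj, norm_mul, norm_inv, Complex.norm_real,
      Real.norm_of_nonneg (weight_pos hv s).le, Real.norm_of_nonneg (one_div_pos.2 (hv.pos s)).le,
      ← div_eq_mul_inv, div_le_div_iff₀ (weight_pos hv s) (hv.pos s), one_mul, mul_comm]
    exact mul_le_mul_of_nonneg_left (norm_exp_neg_I_mul_le z s) (hv.pos s).le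
  refine ⟨innerSL ℂ (hk.toLp k), fun h => ?_⟩
  rw [innerSL_apply_apply, L2.inner_def]
  refine integral_congr_ae ?_
  filter_upwards [hk.coeFn_toLp] with s hs
  simp only [hs, k, RCLike.inner_apply, RCLike.conj_conj, unweighted]
  ring

end SobolevOfL2

/-! ### Resolvent functions -/

/-- The function whose Fourier transform is `z ↦ (l - z)⁻¹` on the strip `|Im z| < |Im l|`. It is
supported on the half-line on which `e^{ils}` decays. -/
def resKernel (l : ℂ) : ℝ → ℂ :=
  {s | 0 < l.im * s}.indicator
    fun s => -(Real.sign l.im : ℂ) * Complex.I * Complex.exp (Complex.I * l * s)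

theorem measurable_resKernel (l : ℂ) : Measurable (resKernel l) :=
  Measurable.indicator (by fun_prop) (measurableSet_lt (by fun_prop) (by fun_prop))

theorem resKernel_neg_neg (l : ℂ) (s : ℝ) : resKernel (-l) (-s) = -resKernel l s := by
  simp [resKernel, Set.indicator_apply, Real.sign_neg, neg_ite]

theorem resKernel_add_mul_I (x r s : ℝ) : resKernel (x + r * Complex.I) s =
    Complex.exp (Complex.I * x * s) * resKernel (r * Complex.I) s := by
  have him : ((x : ℂ) + r * Complex.I).im = (r * Complex.I).im := by simp
  have hexp : Complex.exp (Complex.I * (x + r * Complex.I) * s) =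
      Complex.exp (Complex.I * x * s) * Complex.exp (Complex.I * (r * Complex.I) * s) := by
    rw [← Complex.exp_add]
    ring_nf
  simp only [resKernel, Set.indicator_apply, him, hexp, mul_ite, mul_zero, mul_left_comm]

theorem norm_resKernel_le (l : ℂ) (s : ℝ) : ‖resKernel l s‖ ≤ Real.exp (-|l.im| * |s|) := by
  rw [resKernel, Set.indicator_apply]
  split_ifs with hs
  · have hsign : ‖(-(Real.sign l.im : ℂ) * Complex.I)‖ ≤ 1 := by
      obtain h | h | h := Real.sign_apply_eq l.im <;> simp [h]
    have hexp : ‖Complex.exp (Complex.I * l * s)‖ = Real.exp (-|l.im| * |s|) := by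
      rw [Complex.norm_exp, neg_mul, ← abs_mul, abs_of_pos hs]
      simp
    rw [norm_mul, hexp]
    exact mul_le_of_le_one_left (Real.exp_pos _).le hsign
  · rw [norm_zero]
    exact (Real.exp_pos _).le

theorem integral_exp_mul_resKernel_of_pos {l z : ℂ} (hz : |z.im| < l.im) :
    ∫ s : ℝ, Complex.exp (-Complex.I * s * z) * resKernel l s = (l - z)⁻¹ := by
  have hl : 0 < l.im := (abs_nonneg _).trans_lt hz
  have hre : (Complex.I * (l - z)).re < 0 := by simpa using (abs_lt.1 hz).2
  have hne : l - z ≠ 0 := fun h => by simp [h] at hre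
  have hset : {s : ℝ | 0 < l.im * s} = Set.Ioi 0 := Set.ext fun s => mul_pos_iff_of_pos_left hl
  have hprod : (fun s : ℝ => Complex.exp (-Complex.I * s * z) * resKernel l s) =
      (Set.Ioi 0).indicator fun s : ℝ =>
        -Complex.I * Complex.exp (Complex.I * (l - z) * s) := by
    funext s
    simp only [resKernel, hset, Set.indicator_apply, Real.sign_of_pos hl, Complex.ofReal_one,
      neg_one_mul, mul_ite, mul_zero]
    rw [mul_left_comm, ← Complex.exp_add]
    ring_nf
  rw [hprod, integral_indicator measurableSet_Ioi, integral_const_mul,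
    integral_exp_mul_complex_Ioi hre]
  simp only [Complex.ofReal_zero, mul_zero, Complex.exp_zero]
  field_simp

theorem integral_exp_mul_resKernel {l z : ℂ} (hz : |z.im| < |l.im|) :
    ∫ s : ℝ, Complex.exp (-Complex.I * s * z) * resKernel l s = (l - z)⁻¹ := by
  rcases le_or_gt l.im 0 with hl | hl
  · rw [← integral_neg_eq_self]
    have hreflect (s : ℝ) :
        Complex.exp (-Complex.I * ((-s : ℝ) : ℂ) * z) * resKernel l (-s) =
          -(Complex.exp (-Complex.I * s * -z) * resKernel (-l) s) := by
      rw [← neg_neg (resKernel l (-s)), ← resKernel_neg_neg, neg_neg, mul_neg]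
      push_cast
      ring_nf
    simp only [hreflect]
    rw [integral_neg, integral_exp_mul_resKernel_of_pos, ← neg_sub', inv_neg, neg_neg]
    simpa [abs_of_nonpos hl] using hz
  · exact integral_exp_mul_resKernel_of_pos (by rwa [abs_of_pos hl] at hz)

section ResolventFunctions

variable {v : ℝ → ℝ} (hv : StronglyAdmissible v) {ω : ℝ} (hω : 0 ≤ ω)

include hv hω in
theorem memWeightedL2_resKernel {l : ℂ} (hl : ω < |l.im|) : MemWeightedL2 v ω (resKernel l) :=
  .of_norm_le_exp hv hω (measurable_resKernel l).aestronglyMeasurable hl (C := 1) fun s => by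
    rw [one_mul]
    exact norm_resKernel_le l s

theorem fourierStrip_resKernel {l : ℂ} (hl : ω < |l.im|) :
    fourierStrip ω (resKernel l) = fun z : strip ω => (l - (z : ℂ))⁻¹ :=
  funext fun z => integral_exp_mul_resKernel ((abs_im_le_of_mem_strip z.2).trans_lt hl)

/-- The function `z ↦ (l - z)⁻¹`, as an element of `W²_v(St_ω)`. -/
def resFun {l : ℂ} (hl : ω < |l.im|) : sobolevSpace hv ω :=
  ⟨fun z => (l - (z : ℂ))⁻¹, _, memWeightedL2_resKernel hv hω hl, (fourierStrip_resKernel hl).symm⟩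

/-- The preimage of `resFun hv hω hl` under `sobolevOfL2 hv hω`. -/
def resL2 {l : ℂ} (hl : ω < |l.im|) : Lp ℂ 2 (volume : Measure ℝ) :=
  (memWeightedL2_resKernel hv hω hl).2.toLp _

theorem sobolevOfL2_resL2 {l : ℂ} (hl : ω < |l.im|) :
    sobolevOfL2 hv hω (resL2 hv hω hl) = resFun hv hω hl :=
  Subtype.ext ((sobolevOfL2_toLp hv hω (memWeightedL2_resKernel hv hω hl)).trans
    (fourierStrip_resKernel hl))

theorem coeFn_resL2 {l : ℂ} (hl : ω < |l.im|) :
    resL2 hv hω hl =ᵐ[volume] weighted v ω (resKernel l) :=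
  (memWeightedL2_resKernel hv hω hl).2.coeFn_toLp

include hv hω in
theorem memWeightedL2_ofReal_mul_resKernel {l : ℂ} (hl : ω < |l.im|) :
    MemWeightedL2 v ω fun s => (s : ℂ) * resKernel l s := by
  obtain ⟨δ, hωδ, hδl⟩ := exists_between hl
  refine .of_norm_le_exp hv hω (C := (|l.im| - δ)⁻¹) (δ := δ)
    (Complex.measurable_ofReal.mul (measurable_resKernel l)).aestronglyMeasurable hωδ fun s => ?_
  have hlin : |s| ≤ (|l.im| - δ)⁻¹ * Real.exp ((|l.im| - δ) * |s|) := by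
    rw [le_inv_mul_iff₀ (sub_pos.2 hδl)]
    linarith [Real.add_one_le_exp ((|l.im| - δ) * |s|)]
  rw [norm_mul, Complex.norm_real, Real.norm_eq_abs]
  calc |s| * ‖resKernel l s‖
      ≤ ((|l.im| - δ)⁻¹ * Real.exp ((|l.im| - δ) * |s|)) * Real.exp (-|l.im| * |s|) := by
        gcongr
        exact norm_resKernel_le l s
    _ = (|l.im| - δ)⁻¹ * Real.exp (-δ * |s|) := by
        rw [mul_assoc, ← Real.exp_add]
        ring_nf

theorem lt_abs_im_add_mul_I {r : ℝ} (hr : ω < |r|) (x : ℝ) :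
    ω < |((x : ℂ) + (r : ℂ) * Complex.I).im| := by
  simpa using hr

theorem norm_resL2_add_mul_I_le {r : ℝ} (hr : ω < |r|) (x : ℝ) :
    ‖resL2 hv hω (lt_abs_im_add_mul_I hr x)‖ ≤ ‖resL2 hv hω (lt_abs_im_add_mul_I hr 0)‖ := by
  refine Lp.norm_le_norm_of_ae_le ?_
  filter_upwards [coeFn_resL2 hv hω (lt_abs_im_add_mul_I hr x),
    coeFn_resL2 hv hω (lt_abs_im_add_mul_I hr 0)] with s hx h0
  have hunit (t : ℝ) : ‖Complex.exp (Complex.I * t * s)‖ = 1 := by simp [Complex.norm_exp]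
  rw [hx, h0, norm_weighted hv, norm_weighted hv, resKernel_add_mul_I, resKernel_add_mul_I,
    norm_mul, norm_mul, hunit, hunit]

theorem norm_exp_I_mul_sub_exp_I_mul_le (x y s : ℝ) :
    ‖Complex.exp (Complex.I * x * s) - Complex.exp (Complex.I * y * s)‖ ≤ |x - y| * |s| := by
  have hfactor : Complex.exp (Complex.I * x * s) - Complex.exp (Complex.I * y * s) =
      Complex.exp (Complex.I * y * s) * (Complex.exp (Complex.I * ((x - y) * s : ℝ)) - 1) := by
    rw [mul_sub, ← Complex.exp_add, mul_one]
    push_cast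
    ring_nf
  have hunit : ‖Complex.exp (Complex.I * y * s)‖ = 1 := by simp [Complex.norm_exp]
  rw [hfactor, norm_mul, hunit, one_mul, ← abs_mul]
  exact Real.norm_exp_I_mul_ofReal_sub_one_le

theorem continuous_resL2_add_mul_I {r : ℝ} (hr : ω < |r|) :
    Continuous fun x : ℝ => resL2 hv hω (lt_abs_im_add_mul_I hr x) := by
  have hmem : MemWeightedL2 v ω fun s => (s : ℂ) * resKernel (r * Complex.I) s :=
    memWeightedL2_ofReal_mul_resKernel hv hω (by simpa using hr)
  refine LipschitzWith.continuous (K := ‖hmem.2.toLp _‖₊)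
    (LipschitzWith.of_dist_le_mul fun x y => ?_)
  rw [dist_eq_norm]
  refine (Lp.norm_le_mul_norm_of_ae_le_mul (c := dist x y) ?_).trans_eq (mul_comm _ _)
  filter_upwards [coeFn_resL2 hv hω (lt_abs_im_add_mul_I hr x),
    coeFn_resL2 hv hω (lt_abs_im_add_mul_I hr y), hmem.2.coeFn_toLp,
    Lp.coeFn_sub (resL2 hv hω (lt_abs_im_add_mul_I hr x))
      (resL2 hv hω (lt_abs_im_add_mul_I hr y))] with s hx hy hs hsub
  rw [hsub, Pi.sub_apply, hx, hy, hs, weighted_apply, weighted_apply, ← mul_sub, norm_mul,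
    norm_weighted hv, norm_mul, resKernel_add_mul_I, resKernel_add_mul_I, ← sub_mul, norm_mul,
    Complex.norm_real, Complex.norm_real, Real.norm_of_nonneg (weight_pos hv s).le,
    mul_left_comm (dist x y), Real.dist_eq, Real.norm_eq_abs, ← mul_assoc |x - y|]
  have := (weight_pos hv (ω := ω) s).le
  gcongr
  exact norm_exp_I_mul_sub_exp_I_mul_le x y s

end ResolventFunctions

/-! ### Resolvents and bounded calculi -/

section IsResolventAt

variable {X : Type*} [NormedAddCommGroup X] [NormedSpace ℂ X] {A : X →ₗ.[ℂ] X} {l m : ℂ}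
  {R S : X →L[ℂ] X}

theorem IsResolventAt.unique (hR : IsResolventAt A l R) (hS : IsResolventAt A l S) : R = S := by
  ext x
  obtain ⟨hx, hRx⟩ := hR.1 x
  have hSx := hS.2 ⟨R x, hx⟩
  rw [hRx] at hSx
  exact hSx.symm

theorem IsResolventAt.resolventOp_eq (hR : IsResolventAt A l R) : resolventOp A l = R := by
  have hex : ∃ R, IsResolventAt A l R := ⟨R, hR⟩
  rw [resolventOp, dif_pos hex]
  exact hex.choose_spec.unique hR

theorem IsResolventAt.of_resolvent_identity (hR : IsResolventAt A l R)
    (hleft : S - R = (l - m) • (S * R)) (hright : S - R = (l - m) • (R * S)) :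
    IsResolventAt A m S := by
  constructor
  · intro x
    have hSx : R (x + (l - m) • S x) = S x := by
      rw [map_add, map_smul]
      exact (sub_eq_iff_eq_add'.1 (DFunLike.congr_fun hright x)).symm
    have hA := hR.1 (x + (l - m) • S x)
    rw [hSx] at hA
    obtain ⟨hmem, hA⟩ := hA
    refine ⟨hmem, ?_⟩
    rw [sub_eq_iff_eq_add] at hA ⊢
    rw [← sub_sub_cancel l m, sub_smul, hA]
    abel
  · intro x
    have hRx := hR.2 x
    have hSR := DFunLike.congr_fun hleft (l • (x : X) - A x)
    simp only [sub_apply, smul_apply, mul_apply_eq_comp, hRx] at hSR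
    have hshift : m • (x : X) - A x = (l • (x : X) - A x) - (l - m) • (x : X) := by
      rw [sub_smul]
      abel
    rw [hshift, map_sub, map_smul, ← hSR, sub_sub_cancel]

end IsResolventAt

theorem sub_ne_zero_of_lt_abs_im {ω : ℝ} {l : ℂ} (hl : ω < |l.im|) (z : strip ω) :
    l - (z : ℂ) ≠ 0 := by
  intro h
  rw [sub_eq_zero.1 h] at hl
  exact hl.not_ge (abs_im_le_of_mem_strip z.2)

theorem lt_abs_neg_of_lt {a b : ℝ} (h : a < b) : a < |-b| :=
  h.trans_le ((le_abs_self b).trans_eq (abs_neg b).symm)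

section Cauchy

variable {v : ℝ → ℝ} (hv : StronglyAdmissible v) {ω : ℝ} (hω : 0 ≤ ω) {θ δ : ℝ} {ψ : ℂ → ℂ}

theorem integrable_smul_resL2 {r : ℝ} (hr : ω < |r|) (hrθ : |r| < θ) (hψ : ψ ∈ elementary θ) :
    Integrable fun s : ℝ =>
      ψ ((s : ℂ) + (r : ℂ) * Complex.I) • resL2 hv hω (lt_abs_im_add_mul_I hr s) :=
  (integrable_of_mem_elementary hψ hrθ).smul_bdd _
    (continuous_resL2_add_mul_I hv hω hr).aestronglyMeasurable
    (Eventually.of_forall (norm_resL2_add_mul_I_le hv hω hr))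

/-- The Cauchy integral of `ψ` over the boundary of the strip of height `δ`, as an `L²`-valued
Bochner integral. Applying bounded operators to it yields all other Cauchy integrals. -/
def cauchyL2 (hδ : ω < δ) (ψ : ℂ → ℂ) : Lp ℂ 2 (volume : Measure ℝ) :=
  (2 * (Real.pi : ℂ) * Complex.I)⁻¹ •
    ((∫ s : ℝ, ψ ((s : ℂ) + ((-δ : ℝ) : ℂ) * Complex.I) •
        resL2 hv hω (lt_abs_im_add_mul_I (lt_abs_neg_of_lt hδ) s)) -
      ∫ s : ℝ, ψ ((s : ℂ) + (δ : ℂ) * Complex.I) •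
        resL2 hv hω (lt_abs_im_add_mul_I (hδ.trans_le (le_abs_self δ)) s))

theorem map_cauchyL2 {Y : Type*} [NormedAddCommGroup Y] [NormedSpace ℂ Y] [CompleteSpace Y]
    (L : Lp ℂ 2 (volume : Measure ℝ) →L[ℂ] Y) (hδ : ω < δ) (hδθ : δ < θ)
    (hψ : ψ ∈ elementary θ) :
    L (cauchyL2 hv hω hδ ψ) = (2 * (Real.pi : ℂ) * Complex.I)⁻¹ •
      ((∫ s : ℝ, ψ ((s : ℂ) + ((-δ : ℝ) : ℂ) * Complex.I) •
          L (resL2 hv hω (lt_abs_im_add_mul_I (lt_abs_neg_of_lt hδ) s))) -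
        ∫ s : ℝ, ψ ((s : ℂ) + (δ : ℂ) * Complex.I) •
          L (resL2 hv hω (lt_abs_im_add_mul_I (hδ.trans_le (le_abs_self δ)) s))) := by
  have hδ_abs : |δ| < θ := by rwa [abs_of_pos (hω.trans_lt hδ)]
  rw [cauchyL2, map_smul, map_sub,
    ← L.integral_comp_comm (integrable_smul_resL2 hv hω (lt_abs_neg_of_lt hδ)
      ((abs_neg δ).trans_lt hδ_abs) hψ),
    ← L.integral_comp_comm (integrable_smul_resL2 hv hω (hδ.trans_le (le_abs_self δ)) hδ_abs hψ)]
  simp only [map_smul]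

theorem sobolevOfL2_cauchyL2 (hδ : ω < δ) (hδθ : δ < θ) (hψ : ψ ∈ elementary θ) :
    (sobolevOfL2 hv hω (cauchyL2 hv hω hδ ψ) : strip ω → ℂ) = toStrip ω ψ := by
  funext z
  obtain ⟨ev, hev⟩ := exists_clm_eq_sobolevOfL2_apply hv hω z
  have hev_res {l : ℂ} (hl : ω < |l.im|) : ev (resL2 hv hω hl) = (l - (z : ℂ))⁻¹ := by
    rw [hev, sobolevOfL2_resL2, resFun]
  rw [← hev, map_cauchyL2 hv hω ev hδ hδθ hψ]
  simp only [hev_res, smul_eq_mul]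
  rw [cauchy_formula_of_mem_elementary hψ hδθ ((abs_im_le_of_mem_strip z.2).trans_lt hδ),
    inv_mul_cancel_left₀ Complex.two_pi_I_ne_zero, toStrip]

end Cauchy

section BoundedCalculus

variable {X : Type*} [NormedAddCommGroup X] [NormedSpace ℂ X]

/-- `Ψ` is a bounded `W²_v(St_ω)`-calculus for `A`, i.e., a witness of
`HasBoundedSobolevCalculus hv ω A`. -/
structure IsBoundedCalculus {v : ℝ → ℝ} (hv : StronglyAdmissible v) (ω : ℝ) (A : X →ₗ.[ℂ] X)
    (Ψ : sobolevSpace hv ω →ₗ[ℂ] (X →L[ℂ] X)) : Prop where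
  map_mul : ∀ f g h : sobolevSpace hv ω,
    (h : strip ω → ℂ) = (f : strip ω → ℂ) * (g : strip ω → ℂ) → Ψ h = Ψ f * Ψ g
  bound : ∃ C : ℝ≥0, ∀ f : sobolevSpace hv ω, ‖Ψ f‖ₑ ≤ C * sobolevNorm v ω f
  resolvent : ∃ l : ℂ, ω < |l.im| ∧ ∃ r : sobolevSpace hv ω,
    (r : strip ω → ℂ) = (fun z : strip ω => (l - (z : ℂ))⁻¹) ∧ IsResolventAt A l (Ψ r)

theorem HasBoundedSobolevCalculus.exists_isBoundedCalculus {v : ℝ → ℝ} {hv : StronglyAdmissible v}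
    {ω : ℝ} {A : X →ₗ.[ℂ] X} (hA : HasBoundedSobolevCalculus hv ω A) :
    ∃ Ψ, IsBoundedCalculus hv ω A Ψ :=
  hA.imp fun _ h => ⟨h.1, h.2.1, h.2.2⟩

namespace IsBoundedCalculus

variable {v : ℝ → ℝ} {hv : StronglyAdmissible v} {ω : ℝ} {A : X →ₗ.[ℂ] X}
  {Ψ : sobolevSpace hv ω →ₗ[ℂ] (X →L[ℂ] X)}

theorem isResolventAt (hΨ : IsBoundedCalculus hv ω A Ψ) (hω : 0 ≤ ω) {m : ℂ} (hm : ω < |m.im|) :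
    IsResolventAt A m (Ψ (resFun hv hω hm)) := by
  obtain ⟨l, hl, r, hr, hR⟩ := hΨ.resolvent
  obtain rfl : r = resFun hv hω hl := Subtype.ext hr
  let P : sobolevSpace hv ω :=
    ⟨_, mul_mem_sobolevSpace hv hω (resFun hv hω hm).2 (resFun hv hω hl).2⟩
  have hdiff : resFun hv hω hm - resFun hv hω hl = (l - m) • P := by
    ext z
    change (m - (z : ℂ))⁻¹ - (l - (z : ℂ))⁻¹ = (l - m) * ((m - (z : ℂ))⁻¹ * (l - (z : ℂ))⁻¹)
    rw [inv_sub_inv (sub_ne_zero_of_lt_abs_im hm z) (sub_ne_zero_of_lt_abs_im hl z),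
      sub_sub_sub_cancel_right, div_eq_mul_inv, mul_inv]
  have hΨdiff : Ψ (resFun hv hω hm) - Ψ (resFun hv hω hl) = (l - m) • Ψ P := by
    rw [← map_sub, hdiff, map_smul]
  refine hR.of_resolvent_identity ?_ ?_
  · rw [hΨdiff, hΨ.map_mul _ _ P rfl]
  · rw [hΨdiff, hΨ.map_mul _ _ P (mul_comm _ _)]

theorem exists_clm_eq_sobolevOfL2 (hΨ : IsBoundedCalculus hv ω A Ψ) (hω : 0 ≤ ω) :
    ∃ Φ : Lp ℂ 2 (volume : Measure ℝ) →L[ℂ] (X →L[ℂ] X), ∀ h, Φ h = Ψ (sobolevOfL2 hv hω h) := by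
  obtain ⟨C, hC⟩ := hΨ.bound
  refine ⟨(Ψ ∘ₗ sobolevOfL2 hv hω).mkContinuous C fun h => ?_, fun h => rfl⟩
  have hle : ‖Ψ (sobolevOfL2 hv hω h)‖ₑ ≤ C * ‖h‖ₑ :=
    (hC _).trans (mul_le_mul_right (sobolevNorm_sobolevOfL2_le hv hω h) _)
  rw [enorm_eq_nnnorm, enorm_eq_nnnorm, ← ENNReal.coe_mul, ENNReal.coe_le_coe] at hle
  exact_mod_cast hle

theorem map_eq_cauchyOp [CompleteSpace X] (hΨ : IsBoundedCalculus hv ω A Ψ) (hω : 0 ≤ ω)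
    {θ δ : ℝ} (hδ : ω < δ) (hδθ : δ < θ) {ψ : ℂ → ℂ} (hψ : ψ ∈ elementary θ)
    {p : sobolevSpace hv ω} (hp : (p : strip ω → ℂ) = toStrip ω ψ) : Ψ p = cauchyOp A δ ψ := by
  obtain rfl : p = sobolevOfL2 hv hω (cauchyL2 hv hω hδ ψ) :=
    Subtype.ext (hp.trans (sobolevOfL2_cauchyL2 hv hω hδ hδθ hψ).symm)
  obtain ⟨Φ, hΦ⟩ := hΨ.exists_clm_eq_sobolevOfL2 hω
  have hres {m : ℂ} (hm : ω < |m.im|) : Φ (resL2 hv hω hm) = resolventOp A m := by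
    rw [hΦ, sobolevOfL2_resL2, (hΨ.isResolventAt hω hm).resolventOp_eq]
  rw [← hΦ, map_cauchyL2 hv hω Φ hδ hδθ hψ, cauchyOp]
  simp only [hres, Complex.ofReal_neg, neg_mul, ← sub_eq_add_neg]

theorem map_eq_elemCalc [CompleteSpace X] (hΨ : IsBoundedCalculus hv ω A Ψ) (hω : 0 ≤ ω)
    {ψ : ℂ → ℂ} (hψ : ψ ∈ elementaryGerm ω) {p : sobolevSpace hv ω}
    (hp : (p : strip ω → ℂ) = toStrip ω ψ) : Ψ p = elemCalc ω A ψ := by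
  obtain ⟨θ, hθ, hψθ⟩ := hψ
  obtain ⟨δ, hδ, hδθ⟩ := exists_between hθ
  have hex : ∃ δ, ω < δ ∧ ∃ θ, δ < θ ∧ ψ ∈ elementary θ := ⟨δ, hδ, θ, hδθ, hψθ⟩
  obtain ⟨hωδ, θ', hδθ', hψθ'⟩ := hex.choose_spec
  rw [elemCalc, dif_pos hex]
  exact hΨ.map_eq_cauchyOp hω hωδ hδθ' hψθ' hp

end IsBoundedCalculus

end BoundedCalculus

theorem toStrip_mem_sobolevSpace {v : ℝ → ℝ} (hv : StronglyAdmissible v) {ω : ℝ} (hω : 0 ≤ ω)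
    {ψ : ℂ → ℂ} (hψ : ψ ∈ elementaryGerm ω) : toStrip ω ψ ∈ sobolevSpace hv ω := by
  obtain ⟨θ, hθ, hψθ⟩ := hψ
  obtain ⟨δ, hδ, hδθ⟩ := exists_between hθ
  rw [← sobolevOfL2_cauchyL2 hv hω hδ hδθ hψθ]
  exact Subtype.coe_prop _

/-! ### Gaussian functions -/

section Fourier

open scoped FourierTransform ContDiff

variable {V E : Type*} [NormedAddCommGroup V] [InnerProductSpace ℝ V] [FiniteDimensional ℝ V]
  [MeasurableSpace V] [BorelSpace V] [NormedAddCommGroup E] [NormedSpace ℂ E] [CompleteSpace E]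

theorem ae_eq_zero_of_fourier_eq_zero {u : V → E} (hu : Integrable u) (hFu : 𝓕 u = 0) :
    u =ᵐ[volume] 0 := by
  refine ae_eq_zero_of_integral_contDiff_smul_eq_zero hu.locallyIntegrable fun g hg hgs => ?_
  have hg_compact : HasCompactSupport (Complex.ofRealCLM ∘ g) := hgs.comp_left rfl
  have hg_smooth : ContDiff ℝ ∞ (Complex.ofRealCLM ∘ g) := by fun_prop
  let φ : SchwartzMap V ℂ := hg_compact.toSchwartzMap hg_smooth
  have hswap (χ : SchwartzMap V ℂ) : ∫ s, 𝓕 χ s • u s = ∫ s, χ s • 𝓕 u s := by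
    rw [SchwartzMap.fourier_coe]
    simpa using! VectorFourier.integral_fourierIntegral_smul_eq_flip (L := innerₗ V)
      Real.continuous_fourierChar continuous_inner (χ.integrable (μ := volume)) hu
  calc ∫ s, g s • u s = ∫ s, 𝓕 (𝓕⁻ φ) s • u s := by
        rw [FourierTransform.fourier_fourierInv_eq]
        simp [φ]
    _ = ∫ s, 𝓕⁻ φ s • 𝓕 u s := hswap (𝓕⁻ φ)
    _ = 0 := by simp [hFu]

end Fourier

/-- The Gaussian function `e^{-a(z-t)²}` centred at `t`. -/
def gaussian (a t : ℝ) : ℂ → ℂ := fun z => Complex.exp (-(a : ℂ) * (z - t) ^ 2)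

theorem gauss_eq_gaussian : gauss = gaussian 1 0 := by
  funext z
  simp [gauss, gaussian]

theorem gaussian_two_eq (t : ℝ) :
    gaussian 2 t = Complex.exp (2 * t ^ 2) • (gaussian 1 (2 * t) * gauss) := by
  funext z
  simp only [gaussian, gauss, Pi.smul_apply, Pi.mul_apply, smul_eq_mul, ← Complex.exp_add]
  congr 1
  push_cast
  ring

/-- The inverse Fourier transform of `gaussian a t`, a modulated Gaussian. -/
def gaussianKernel (a t s : ℝ) : ℂ :=
  (√(4 * Real.pi * a) : ℂ)⁻¹ * (Complex.exp (Complex.I * t * s) * Real.exp (-s ^ 2 / (4 * a)))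

theorem continuous_gaussianKernel (a t : ℝ) : Continuous (gaussianKernel a t) := by
  unfold gaussianKernel
  fun_prop

theorem norm_gaussianKernel (a t s : ℝ) :
    ‖gaussianKernel a t s‖ = (√(4 * Real.pi * a))⁻¹ * Real.exp (-s ^ 2 / (4 * a)) := by
  have hunit : ‖Complex.exp (Complex.I * t * s)‖ = 1 := by simp [Complex.norm_exp]
  rw [gaussianKernel, norm_mul, norm_mul, hunit, one_mul, norm_inv, Complex.norm_real,
    Complex.norm_real, Real.norm_of_nonneg (Real.sqrt_nonneg _),
    Real.norm_of_nonneg (Real.exp_pos _).le]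

theorem gaussianKernel_ne_zero {a : ℝ} (ha : 0 < a) (t s : ℝ) : gaussianKernel a t s ≠ 0 := by
  rw [← norm_pos_iff, norm_gaussianKernel]
  positivity

theorem conj_gaussianKernel (a t s : ℝ) : starRingEnd ℂ (gaussianKernel a t s) =
    Complex.exp (-Complex.I * t * s) * gaussianKernel a 0 s := by
  simp only [gaussianKernel, map_mul, map_inv₀, Complex.conj_ofReal, ← Complex.exp_conj,
    Complex.conj_I, Complex.ofReal_zero, mul_zero, zero_mul, Complex.exp_zero, one_mul]
  ring

section GaussianL2

variable {v : ℝ → ℝ} (hv : StronglyAdmissible v) {ω : ℝ} (hω : 0 ≤ ω) {a : ℝ} (ha : 0 < a)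

include hv hω ha in
theorem memWeightedL2_gaussianKernel (t : ℝ) : MemWeightedL2 v ω (gaussianKernel a t) := by
  refine .of_norm_le_exp hv hω (δ := ω + 1)
    (C := (√(4 * Real.pi * a))⁻¹ * Real.exp (a * (ω + 1) ^ 2))
    (continuous_gaussianKernel a t).aestronglyMeasurable (lt_add_one ω) fun s => ?_
  rw [norm_gaussianKernel, mul_assoc (√(4 * Real.pi * a))⁻¹, ← Real.exp_add]
  gcongr
  have hsq : a * (ω + 1) ^ 2 + -(ω + 1) * |s| - -s ^ 2 / (4 * a) =
      (|s| - 2 * a * (ω + 1)) ^ 2 / (4 * a) := by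
    field_simp
    rw [← sq_abs s]
    ring
  rw [← sub_nonneg, hsq]
  positivity

include ha in
theorem fourierStrip_gaussianKernel (t : ℝ) :
    fourierStrip ω (gaussianKernel a t) = toStrip ω (gaussian a t) := by
  funext z
  have ha₀ : (a : ℂ) ≠ 0 := Complex.ofReal_ne_zero.2 ha.ne'
  have hb : 0 < (((4 * a)⁻¹ : ℝ) : ℂ).re := by
    rw [Complex.ofReal_re]
    positivity
  have hconst : ((Real.pi : ℂ) / ((4 * a)⁻¹ : ℝ)) ^ (1 / 2 : ℂ) = √(4 * Real.pi * a) := by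
    rw [Real.sqrt_eq_rpow, Complex.ofReal_cpow (by positivity)]
    congr 1
    · push_cast
      field_simp
    · norm_num
  have hprod (s : ℝ) : Complex.exp (-Complex.I * s * (z : ℂ)) * gaussianKernel a t s =
      (√(4 * Real.pi * a) : ℂ)⁻¹ * (Complex.exp (Complex.I * (t - z) * s) *
        Complex.exp (-((4 * a)⁻¹ : ℝ) * s ^ 2)) := by
    rw [gaussianKernel, mul_left_comm, Complex.ofReal_exp, ← Complex.exp_add, ← Complex.exp_add,
      ← Complex.exp_add]
    congr 2
    push_cast
    field_simp
    ring
  have hsqrt : (√(4 * Real.pi * a) : ℂ) ≠ 0 := Complex.ofReal_ne_zero.2 (by positivity)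
  simp only [fourierStrip, hprod, integral_const_mul]
  rw [fourierIntegral_gaussian hb, hconst, inv_mul_cancel_left₀ hsqrt, toStrip, gaussian]
  congr 1
  push_cast
  field_simp
  ring

/-- The preimage of `gaussian a t` under `sobolevOfL2 hv hω`. -/
def gaussianL2 (t : ℝ) : Lp ℂ 2 (volume : Measure ℝ) :=
  (memWeightedL2_gaussianKernel hv hω ha t).2.toLp _

theorem sobolevOfL2_gaussianL2 (t : ℝ) :
    (sobolevOfL2 hv hω (gaussianL2 hv hω ha t) : strip ω → ℂ) = toStrip ω (gaussian a t) :=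
  (sobolevOfL2_toLp hv hω (memWeightedL2_gaussianKernel hv hω ha t)).trans
    (fourierStrip_gaussianKernel ha t)

-- The Fourier transform of `weighted v ω (gaussianKernel a 0) * q` at `ξ` is the inner product of
-- `q` with the modulated Gaussian centred at `2πξ`.
open scoped FourierTransform in
theorem topologicalClosure_span_gaussianL2 :
    (Submodule.span ℂ (Set.range (gaussianL2 hv hω ha))).topologicalClosure = ⊤ := by
  rw [Submodule.topologicalClosure_eq_top_iff, Submodule.eq_bot_iff]
  intro q hq
  have hint : Integrable (fun s => weighted v ω (gaussianKernel a 0) s * q s) :=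
    (memWeightedL2_gaussianKernel hv hω ha 0).2.integrable_mul (Lp.memLp q)
  have hFourier : 𝓕 (fun s => weighted v ω (gaussianKernel a 0) s * q s) = 0 := by
    funext ξ
    have horth := (Submodule.mem_orthogonal _ _).1 hq _
      (Submodule.subset_span (Set.mem_range_self (2 * Real.pi * ξ)))
    rw [L2.inner_def] at horth
    rw [Pi.zero_apply, ← horth, Real.fourier_eq']
    refine integral_congr_ae ?_
    filter_upwards [(memWeightedL2_gaussianKernel hv hω ha (2 * Real.pi * ξ)).2.coeFn_toLp]
      with s hs
    rw [gaussianL2, hs, RCLike.inner_apply (𝕜 := ℂ), weighted_apply, weighted_apply, map_mul,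
      conj_gaussianKernel, Complex.conj_ofReal, smul_eq_mul]
    have hexp : Complex.exp (((-2 * Real.pi * inner ℝ s ξ : ℝ) : ℂ) * Complex.I) =
        Complex.exp (-Complex.I * (2 * Real.pi * ξ : ℝ) * s) := by
      congr 1
      simp only [RCLike.inner_apply, Real.ringHom_apply]
      push_cast
      ring
    rw [hexp]
    ring
  apply Lp.ext
  filter_upwards [ae_eq_zero_of_fourier_eq_zero hint hFourier,
    Lp.coeFn_zero ℂ 2 (volume : Measure ℝ)] with s hs hzero
  rw [hzero]
  refine (mul_eq_zero.1 hs).resolve_left ?_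
  exact mul_ne_zero (ofReal_weight_ne_zero hv s) (gaussianKernel_ne_zero ha 0 s)

include hω ha in
theorem exists_span_gaussian_tendsto_sobolevNorm {f : strip ω → ℂ} (hf : f ∈ sobolevSpace hv ω) :
    ∃ φ : ℕ → ℂ → ℂ, (∀ n, φ n ∈ Submodule.span ℂ (Set.range (gaussian a))) ∧
      Tendsto (fun n => sobolevNorm v ω (toStrip ω (φ n) - f)) atTop (𝓝 0) := by
  obtain ⟨h, hh⟩ := sobolevOfL2_surjective hv hω ⟨f, hf⟩
  have hclosure : h ∈ closure (Submodule.span ℂ (Set.range (gaussianL2 hv hω ha)) :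
      Set (Lp ℂ 2 (volume : Measure ℝ))) := by
    rw [← Submodule.topologicalClosure_coe, topologicalClosure_span_gaussianL2 hv hω ha]
    trivial
  obtain ⟨k, hk, hkh⟩ := mem_closure_iff_seq_limit.1 hclosure
  have hmap : (Submodule.span ℂ (Set.range (gaussianL2 hv hω ha))).map
        ((sobolevSpace hv ω).subtype ∘ₗ sobolevOfL2 hv hω) =
      (Submodule.span ℂ (Set.range (gaussian a))).map (LinearMap.funLeft ℂ ℂ Subtype.val) := by
    rw [Submodule.map_span, Submodule.map_span, ← Set.range_comp, ← Set.range_comp]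
    exact congrArg (fun g => Submodule.span ℂ (Set.range g))
      (funext fun t => sobolevOfL2_gaussianL2 hv hω ha t)
  have hrep (n : ℕ) : ∃ φ ∈ Submodule.span ℂ (Set.range (gaussian a)),
      toStrip ω φ = sobolevOfL2 hv hω (k n) :=
    hmap.le (Submodule.mem_map_of_mem (hk n))
  choose φ hφ hφk using hrep
  refine ⟨φ, hφ, ?_⟩
  have hlim : Tendsto (fun n => ‖k n - h‖ₑ) atTop (𝓝 0) := by
    simpa using (tendsto_sub_nhds_zero_iff.2 hkh).enorm
  refine tendsto_of_tendsto_of_tendsto_of_le_of_le tendsto_const_nhds hlim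
    (fun n => zero_le) (fun n => ?_)
  have hdiff : toStrip ω (φ n) - f = sobolevOfL2 hv hω (k n - h) := by
    rw [map_sub, hh, Submodule.coe_sub, ← hφk]
  simpa only [hdiff] using sobolevNorm_sobolevOfL2_le hv hω (k n - h)

end GaussianL2

section Elementary

variable {θ : ℝ}

theorem mem_elementary_iff {ψ : ℂ → ℂ} : ψ ∈ elementary θ ↔
    DifferentiableOn ℂ ψ (openStrip θ) ∧ (∃ C : ℝ, ∀ z ∈ openStrip θ, ‖ψ z‖ ≤ C) ∧
      ∃ K < ∞, ∀ r : ℝ, |r| < θ → ∫⁻ s : ℝ, ‖ψ (s + r * Complex.I)‖ₑ ≤ K :=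
  and_congr_right' <| and_congr_right'
    ⟨fun h => ⟨_, h, fun r hr => le_iSup₂ (f := fun (r : ℝ) (_ : |r| < θ) =>
      ∫⁻ s : ℝ, ‖ψ (s + r * Complex.I)‖ₑ) r hr⟩,
      fun ⟨_, hK, h⟩ => (iSup₂_le h).trans_lt hK⟩

/-- The space `𝓔(St_θ)` of elementary functions as a linear subspace. -/
def elementarySubmodule (θ : ℝ) : Submodule ℂ (ℂ → ℂ) where
  carrier := elementary θ
  zero_mem' := mem_elementary_iff.2
    ⟨differentiableOn_const 0, ⟨0, fun z _ => by simp⟩, 0, ENNReal.zero_lt_top, by simp⟩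
  add_mem' {ψ φ} hψ hφ := by
    obtain ⟨hψd, ⟨C, hC⟩, K, hK, hψK⟩ := mem_elementary_iff.1 hψ
    obtain ⟨hφd, ⟨B, hB⟩, M, hM, hφM⟩ := mem_elementary_iff.1 hφ
    refine mem_elementary_iff.2 ⟨hψd.add hφd,
      ⟨C + B, fun z hz => norm_add_le_of_le (hC z hz) (hB z hz)⟩,
      K + M, ENNReal.add_lt_top.2 ⟨hK, hM⟩, fun r hr => ?_⟩
    calc ∫⁻ s : ℝ, ‖(ψ + φ) (s + r * Complex.I)‖ₑ
        ≤ ∫⁻ s : ℝ, ‖ψ (s + r * Complex.I)‖ₑ + ‖φ (s + r * Complex.I)‖ₑ :=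
          lintegral_mono fun s => enorm_add_le _ _
      _ = (∫⁻ s : ℝ, ‖ψ (s + r * Complex.I)‖ₑ) + ∫⁻ s : ℝ, ‖φ (s + r * Complex.I)‖ₑ :=
          lintegral_add_left' (integrable_of_mem_elementary hψ hr).1.enorm _
      _ ≤ K + M := add_le_add (hψK r hr) (hφM r hr)
  smul_mem' c ψ hψ := by
    obtain ⟨hψd, ⟨C, hC⟩, K, hK, hψK⟩ := mem_elementary_iff.1 hψ
    refine mem_elementary_iff.2 ⟨hψd.const_smul c, ⟨‖c‖ * C, fun z hz => ?_⟩,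
      ‖c‖ₑ * K, ENNReal.mul_lt_top enorm_lt_top hK, fun r hr => ?_⟩
    · rw [Pi.smul_apply, norm_smul]
      exact mul_le_mul_of_nonneg_left (hC z hz) (norm_nonneg c)
    · simp only [Pi.smul_apply, enorm_smul]
      rw [lintegral_const_mul'' _ (integrable_of_mem_elementary hψ hr).1.enorm]
      exact mul_le_mul_right (hψK r hr) _

theorem norm_gaussian (a t : ℝ) (z : ℂ) :
    ‖gaussian a t z‖ = Real.exp (a * z.im ^ 2) * Real.exp (-a * (z.re - t) ^ 2) := by
  rw [gaussian, Complex.norm_exp, ← Real.exp_add]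
  congr 1
  simp only [sq, neg_mul, Complex.neg_re, Complex.mul_re, Complex.ofReal_re, Complex.sub_re,
    Complex.sub_im, Complex.ofReal_im, Complex.mul_im, sub_zero, zero_mul]
  ring

theorem norm_gaussian_le {a : ℝ} (ha : 0 ≤ a) (t : ℝ) {z : ℂ} (hz : z ∈ openStrip θ) :
    ‖gaussian a t z‖ ≤ Real.exp (a * θ ^ 2) * Real.exp (-a * (z.re - t) ^ 2) := by
  rw [norm_gaussian]
  gcongr ?_ * _
  have hz' : |z.im| ≤ |θ| := (le_of_lt hz).trans (le_abs_self θ)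
  have := sq_le_sq.2 hz'
  gcongr

theorem gaussian_mem_elementary (θ : ℝ) {a : ℝ} (ha : 0 < a) (t : ℝ) :
    gaussian a t ∈ elementary θ := by
  have hint : Integrable fun s : ℝ => Real.exp (a * θ ^ 2) * Real.exp (-a * (s - t) ^ 2) :=
    ((integrable_exp_neg_mul_sq ha).comp_sub_right t).const_mul _
  refine mem_elementary_iff.2 ⟨by unfold gaussian; fun_prop,
    ⟨Real.exp (a * θ ^ 2), fun z hz => (norm_gaussian_le ha.le t hz).trans ?_⟩,
    _, hint.2, fun r hr => lintegral_mono fun s => ?_⟩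
  · refine mul_le_of_le_one_right (Real.exp_pos _).le (Real.exp_le_one_iff.2 ?_)
    rw [neg_mul]
    exact neg_nonpos.2 (by positivity)
  · have hs : (s + r * Complex.I : ℂ) ∈ openStrip θ := by simpa [openStrip] using hr
    have hle := norm_gaussian_le ha.le t hs
    simp only [Complex.add_re, Complex.ofReal_re, Complex.mul_re, Complex.I_re, mul_zero,
      Complex.ofReal_im, Complex.I_im, mul_one, sub_self, add_zero] at hle
    exact enorm_le_iff_norm_le.2 (hle.trans (le_abs_self _))

theorem span_gaussian_subset_elementaryGerm (ω : ℝ) {a : ℝ} (ha : 0 < a) :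
    (Submodule.span ℂ (Set.range (gaussian a)) : Set (ℂ → ℂ)) ⊆ elementaryGerm ω := by
  have hspan : Submodule.span ℂ (Set.range (gaussian a)) ≤ elementarySubmodule (ω + 1) :=
    Submodule.span_le.2 (Set.range_subset_iff.2 (gaussian_mem_elementary (ω + 1) ha))
  exact fun ψ hψ => ⟨ω + 1, lt_add_one ω, hspan hψ⟩

theorem gaussian_mem_elementaryGerm (ω : ℝ) {a : ℝ} (ha : 0 < a) (t : ℝ) :
    gaussian a t ∈ elementaryGerm ω :=
  ⟨ω + 1, lt_add_one ω, gaussian_mem_elementary (ω + 1) ha t⟩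

end Elementary

/-! ### The elementary Sobolev calculus -/

section ElementaryCalculus

variable {X : Type*} [NormedAddCommGroup X] [NormedSpace ℂ X] {v : ℝ → ℝ}
  {hv : StronglyAdmissible v} {ω : ℝ} {A : X →ₗ.[ℂ] X}

namespace IsBoundedCalculus

variable {Ψ : sobolevSpace hv ω →ₗ[ℂ] (X →L[ℂ] X)} {ι : Type*} {l : Filter ι}

theorem tendsto_map_zero (hΨ : IsBoundedCalculus hv ω A Ψ) {p : ι → sobolevSpace hv ω}
    (hp : Tendsto (fun i => sobolevNorm v ω (p i)) l (𝓝 0)) :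
    Tendsto (fun i => Ψ (p i)) l (𝓝 0) := by
  obtain ⟨C, hC⟩ := hΨ.bound
  have hlim : Tendsto (fun i => (C : ℝ≥0∞) * sobolevNorm v ω (p i)) l (𝓝 0) := by
    simpa using ENNReal.Tendsto.const_mul hp (Or.inr ENNReal.coe_ne_top)
  exact tendsto_zero_iff_enorm_tendsto_zero.2 (tendsto_of_tendsto_of_tendsto_of_le_of_le
    tendsto_const_nhds hlim (fun _ => zero_le) fun i => hC (p i))

theorem tendsto_map (hΨ : IsBoundedCalculus hv ω A Ψ) {p : ι → sobolevSpace hv ω}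
    {q : sobolevSpace hv ω} (hp : Tendsto (fun i => sobolevNorm v ω ↑(p i - q)) l (𝓝 0)) :
    Tendsto (fun i => Ψ (p i)) l (𝓝 (Ψ q)) := by
  simpa only [map_sub, tendsto_sub_nhds_zero_iff] using hΨ.tendsto_map_zero hp

theorem map_mul_apply (hΨ : IsBoundedCalculus hv ω A Ψ) {p q r : sobolevSpace hv ω}
    (hr : (r : strip ω → ℂ) = p * q) (x : X) : Ψ r x = Ψ p (Ψ q x) :=
  DFunLike.congr_fun (hΨ.map_mul p q r hr) x

theorem commute (hΨ : IsBoundedCalculus hv ω A Ψ) (hω : 0 ≤ ω) (p q : sobolevSpace hv ω) :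
    Commute (Ψ p) (Ψ q) := by
  have hpq := hΨ.map_mul p q ⟨_, mul_mem_sobolevSpace hv hω p.2 q.2⟩ rfl
  exact hpq.symm.trans (hΨ.map_mul q p _ (mul_comm _ _))

theorem eq_zero_of_forall_map_apply_eq_zero (hΨ : IsBoundedCalculus hv ω A Ψ) {x : X}
    (hx : ∀ p, Ψ p x = 0) : x = 0 := by
  obtain ⟨l, -, r, -, hR⟩ := hΨ.resolvent
  obtain ⟨hdom, hres⟩ := hR.1 x
  have hzero : (⟨Ψ r x, hdom⟩ : A.domain) = 0 := Subtype.ext (hx r)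
  rw [hzero, A.map_zero, hx, smul_zero, sub_zero] at hres
  exact hres.symm

theorem eq_zero_of_forall_map_gaussianL2_apply_eq_zero (hΨ : IsBoundedCalculus hv ω A Ψ)
    (hω : 0 ≤ ω) {a : ℝ} (ha : 0 < a) {x : X}
    (hx : ∀ t, Ψ (sobolevOfL2 hv hω (gaussianL2 hv hω ha t)) x = 0) : x = 0 := by
  obtain ⟨Φ, hΦ⟩ := hΨ.exists_clm_eq_sobolevOfL2 hω
  have hdense : Dense (Submodule.span ℂ (Set.range (gaussianL2 hv hω ha)) :
      Set (Lp ℂ 2 (volume : Measure ℝ))) :=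
    Submodule.dense_iff_topologicalClosure_eq_top.2 (topologicalClosure_span_gaussianL2 hv hω ha)
  have hzero : ContinuousLinearMap.apply ℂ X x ∘L Φ = 0 := by
    refine ContinuousLinearMap.ext_on hdense ?_
    rintro _ ⟨t, rfl⟩
    exact (DFunLike.congr_fun (hΦ _) x).trans (hx t)
  refine hΨ.eq_zero_of_forall_map_apply_eq_zero fun p => ?_
  obtain ⟨h, rfl⟩ := sobolevOfL2_surjective hv hω p
  rw [← hΦ]
  exact DFunLike.congr_fun hzero h

theorem eq_zero_of_map_gauss_apply_eq_zero (hΨ : IsBoundedCalculus hv ω A Ψ) (hω : 0 ≤ ω)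
    {G : sobolevSpace hv ω} (hG : (G : strip ω → ℂ) = toStrip ω gauss) {x : X} (hx : Ψ G x = 0) :
    x = 0 := by
  refine hΨ.eq_zero_of_forall_map_gaussianL2_apply_eq_zero hω two_pos fun t => ?_
  have hfactor : (sobolevOfL2 hv hω (gaussianL2 hv hω two_pos t) : strip ω → ℂ) =
      (Complex.exp (2 * t ^ 2) •
        sobolevOfL2 hv hω (gaussianL2 hv hω one_pos (2 * t)) : sobolevSpace hv ω) * G := by
    rw [sobolevOfL2_gaussianL2, gaussian_two_eq, Submodule.coe_smul, sobolevOfL2_gaussianL2, hG,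
      smul_mul_assoc]
    rfl
  rw [hΨ.map_mul_apply hfactor, hx, map_zero]

variable [CompleteSpace X]

theorem tendsto_elemCalc (hΨ : IsBoundedCalculus hv ω A Ψ) (hω : 0 ≤ ω) {ψ : ι → ℂ → ℂ}
    (hψ : ∀ i, ψ i ∈ elementaryGerm ω) {q : sobolevSpace hv ω}
    (hψq : Tendsto (fun i => sobolevNorm v ω (toStrip ω (ψ i) - q)) l (𝓝 0)) :
    Tendsto (fun i => elemCalc ω A (ψ i)) l (𝓝 (Ψ q)) := by
  refine (hΨ.tendsto_map (p := fun i => ⟨_, toStrip_mem_sobolevSpace hv hω (hψ i)⟩) hψq).congr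
    fun i => ?_
  exact hΨ.map_eq_elemCalc hω (hψ i) rfl

theorem sobolevCalc_iff (hΨ : IsBoundedCalculus hv ω A Ψ) (hω : 0 ≤ ω) {f : strip ω → ℂ}
    {T : X →L[ℂ] X} : SobolevCalc hv ω A f T ↔ ∃ hf : f ∈ sobolevSpace hv ω, Ψ ⟨f, hf⟩ = T := by
  constructor
  · rintro ⟨hf, ψ, hψ, hψf, hψT⟩
    exact ⟨hf, tendsto_nhds_unique (hΨ.tendsto_elemCalc hω hψ (q := ⟨f, hf⟩) hψf) hψT⟩
  · rintro ⟨hf, rfl⟩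
    obtain ⟨φ, hφ, hφf⟩ := exists_span_gaussian_tendsto_sobolevNorm hv hω one_pos hf
    have hgerm (n : ℕ) := span_gaussian_subset_elementaryGerm ω one_pos (hφ n)
    exact ⟨hf, φ, hgerm, hφf, hΨ.tendsto_elemCalc hω hgerm (q := ⟨f, hf⟩) hφf⟩

theorem mem_funCalc_iff (hΨ : IsBoundedCalculus hv ω A Ψ) (hω : 0 ≤ ω) {f : strip ω → ℂ}
    {x y : X} : (x, y) ∈ funCalc hv ω A f ↔
      ∀ p q : sobolevSpace hv ω, (q : strip ω → ℂ) = p * f → Ψ p y = Ψ q x := by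
  constructor
  · intro h p q hq
    exact h p _ _ ((hΨ.sobolevCalc_iff hω).2 ⟨p.2, rfl⟩)
      ((hΨ.sobolevCalc_iff hω).2 ⟨hq ▸ q.2, congrArg Ψ (Subtype.ext hq.symm)⟩)
  · intro h e T S hT hS
    obtain ⟨he, rfl⟩ := (hΨ.sobolevCalc_iff hω).1 hT
    obtain ⟨hef, rfl⟩ := (hΨ.sobolevCalc_iff hω).1 hS
    exact h ⟨e, he⟩ ⟨e * f, hef⟩ rfl

end IsBoundedCalculus

end ElementaryCalculus

/-! ### The convergence lemma -/

section StrongLimit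

variable {𝕜 X Y ι : Type*} [NontriviallyNormedField 𝕜] [NormedAddCommGroup X] [NormedSpace 𝕜 X]
  [NormedAddCommGroup Y] [NormedSpace 𝕜 Y] [CompleteSpace Y] {l : Filter ι} [l.NeBot]
  {T : ι → X →L[𝕜] Y} {C : ℝ}

theorem exists_clm_tendsto_of_dense (hT : ∀ i, ‖T i‖ ≤ C) {V : Submodule 𝕜 X}
    (hV : Dense (V : Set X)) (hlim : ∀ x ∈ V, ∃ y, Tendsto (fun i => T i x) l (𝓝 y)) :
    ∃ S : X →L[𝕜] Y, ∀ x, Tendsto (fun i => T i x) l (𝓝 (S x)) := by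
  choose f hf using fun x : V => hlim x x.2
  have hbdd : Bornology.IsBounded (Set.range fun i => T i ∘L V.subtypeL) :=
    isBounded_iff_forall_norm_le.2 ⟨C * ‖V.subtypeL‖, Set.forall_mem_range.2 fun i =>
      ((T i).opNorm_comp_le _).trans (mul_le_mul_of_nonneg_right (hT i) (norm_nonneg _))⟩
  let S₀ := ContinuousLinearMap.ofTendstoOfBoundedRange f _ (tendsto_pi_nhds.2 hf) hbdd
  let S := S₀.extend V.subtypeL
  have hSV (x : V) : S x = f x :=
    S₀.extend_eq (e := V.subtypeL) hV.denseRange_val (isUniformInducing_val _) x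
  have hequi : Equicontinuous fun i => (T i : X → Y) :=
    (show _ ↔ ∃ C, ∀ i, ‖T i‖ ≤ C from (NormedSpace.equicontinuous_TFAE T).out 1 5).2 ⟨C, hT⟩
  have hclosed : IsClosed {x | Tendsto (fun i => T i x) l (𝓝 (S x))} :=
    hequi.isClosed_setOfPred_tendsto S.continuous
  have hsubset : (V : Set X) ⊆ {x | Tendsto (fun i => T i x) l (𝓝 (S x))} := fun x hx => by
    simpa only [Set.mem_ofPred_eq, hSV ⟨x, hx⟩] using hf ⟨x, hx⟩
  exact ⟨S, fun x => hclosed.closure_subset_iff.2 hsubset (hV x)⟩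

omit [CompleteSpace Y] in
theorem eq_graph_of_isClosed_of_dense {S : X →L[𝕜] Y} {Γ : Submodule 𝕜 (X × Y)}
    (hΓ : IsClosed (Γ : Set (X × Y))) (hsingle : ∀ y, (0, y) ∈ Γ → y = 0) {s : Set X}
    (hs : Dense s) (h : ∀ x ∈ s, (x, S x) ∈ Γ) : Γ = (S : X →ₗ[𝕜] Y).graph := by
  have hgraph (x : X) : (x, S x) ∈ Γ :=
    (hΓ.preimage (continuous_id.prodMk S.continuous)).closure_subset_iff.2 h (hs x)
  ext ⟨x, y⟩
  rw [LinearMap.mem_graph_iff]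
  refine ⟨fun hxy => sub_eq_zero.1 (hsingle _ ?_), ?_⟩
  · simpa using Γ.sub_mem hxy (hgraph x)
  · rintro (rfl : y = S x)
    exact hgraph x

theorem exists_graph_eq_and_tendsto (hT : ∀ i, ‖T i‖ ≤ C) {Γ : Submodule 𝕜 (X × Y)}
    (hΓ : IsClosed (Γ : Set (X × Y))) (hsingle : ∀ y, (0, y) ∈ Γ → y = 0) {s : Set X}
    (hs : Dense (Submodule.span 𝕜 s : Set X))
    (hlim : ∀ x ∈ s, ∃ y, Tendsto (fun i => T i x) l (𝓝 y) ∧ (x, y) ∈ Γ) :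
    ∃ S : X →L[𝕜] Y, Γ = (S : X →ₗ[𝕜] Y).graph ∧ ∀ x, Tendsto (fun i => T i x) l (𝓝 (S x)) := by
  have hspan (x : X) (hx : x ∈ Submodule.span 𝕜 s) :
      ∃ y, Tendsto (fun i => T i x) l (𝓝 y) ∧ (x, y) ∈ Γ := by
    induction hx using Submodule.span_induction with
    | mem x hx => exact hlim x hx
    | zero => exact ⟨0, by simp, Γ.zero_mem⟩
    | add x x' _ _ hx hx' =>
      obtain ⟨⟨y, hy, hxy⟩, y', hy', hxy'⟩ := hx, hx'
      exact ⟨y + y', by simpa using hy.add hy', Γ.add_mem hxy hxy'⟩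
    | smul c x _ hx =>
      obtain ⟨y, hy, hxy⟩ := hx
      exact ⟨c • y, by simpa using hy.const_smul c, Γ.smul_mem c hxy⟩
  obtain ⟨S, hS⟩ := exists_clm_tendsto_of_dense hT hs fun x hx => (hspan x hx).imp fun _ => And.left
  refine ⟨S, eq_graph_of_isClosed_of_dense hΓ hsingle hs fun x hx => ?_, hS⟩
  obtain ⟨y, hy, hxy⟩ := hspan x hx
  rwa [tendsto_nhds_unique (hS x) hy]

end StrongLimit

section FunCalc

variable {X : Type*} [NormedAddCommGroup X] [NormedSpace ℂ X] {v : ℝ → ℝ}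
  {hv : StronglyAdmissible v} {ω : ℝ} {A : X →ₗ.[ℂ] X}

theorem isClosed_funCalc (f : strip ω → ℂ) : IsClosed (funCalc hv ω A f : Set (X × X)) := by
  have hinter : (funCalc hv ω A f : Set (X × X)) = ⋂ (e : strip ω → ℂ) (T : X →L[ℂ] X)
      (S : X →L[ℂ] X) (_ : SobolevCalc hv ω A e T) (_ : SobolevCalc hv ω A (e * f) S),
        {p | T p.2 = S p.1} := by
    ext p
    simp [funCalc]
  rw [hinter]
  refine isClosed_iInter fun e => isClosed_iInter fun T => isClosed_iInter fun S =>
    isClosed_iInter fun _ => isClosed_iInter fun _ => isClosed_eq ?_ ?_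
  exacts [T.continuous.comp continuous_snd, S.continuous.comp continuous_fst]

theorem FunCalcEq.mem_funCalc_iff {f : strip ω → ℂ} {T : X →L[ℂ] X} (hT : FunCalcEq hv ω A f T)
    {x y : X} : (x, y) ∈ funCalc hv ω A f ↔ y = T x := by
  rw [show funCalc hv ω A f = _ from hT]
  exact LinearMap.mem_graph_iff _ _

theorem gauss_mul_mem_sobolevSpace (hv : StronglyAdmissible v) {f : strip ω → ℂ}
    (hf : f ∈ horSpace v ω) : toStrip ω gauss * f ∈ sobolevSpace hv ω := by
  have hle : sobolevNorm v ω (fun z => gauss ((z : ℂ) - (0 : ℝ)) * f z) ≤ horNorm v ω f :=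
    le_iSup (fun t : ℝ => sobolevNorm v ω (fun z => gauss ((z : ℂ) - t) * f z)) 0
  simp only [Complex.ofReal_zero, sub_zero] at hle
  exact mem_sobolevSpace_of_sobolevNorm_lt_top hv (hle.trans_lt hf)

namespace IsBoundedCalculus

variable [CompleteSpace X] {Ψ : sobolevSpace hv ω →ₗ[ℂ] (X →L[ℂ] X)} {f F : strip ω → ℂ}

theorem eq_zero_of_zero_mem_funCalc (hΨ : IsBoundedCalculus hv ω A Ψ) (hω : 0 ≤ ω)
    (hf : f ∈ horSpace v ω) {y : X} (hy : (0, y) ∈ funCalc hv ω A f) : y = 0 := by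
  have hG : toStrip ω gauss ∈ sobolevSpace hv ω :=
    toStrip_mem_sobolevSpace hv hω (gauss_eq_gaussian ▸ gaussian_mem_elementaryGerm ω one_pos 0)
  refine hΨ.eq_zero_of_map_gauss_apply_eq_zero hω (G := ⟨_, hG⟩) rfl ?_
  rw [(hΨ.mem_funCalc_iff hω).1 hy _ ⟨_, gauss_mul_mem_sobolevSpace hv hf⟩ rfl, map_zero]

theorem map_mem_funCalc (hΨ : IsBoundedCalculus hv ω A Ψ) (hω : 0 ≤ ω) (p : sobolevSpace hv ω)
    {x y : X} (hxy : (x, y) ∈ funCalc hv ω A f) : (Ψ p x, Ψ p y) ∈ funCalc hv ω A f := by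
  rw [hΨ.mem_funCalc_iff hω] at hxy ⊢
  intro q qf hqf
  have hcomm (q : sobolevSpace hv ω) (z : X) : Ψ q (Ψ p z) = Ψ p (Ψ q z) :=
    DFunLike.congr_fun (hΨ.commute hω q p).eq z
  rw [hcomm, hxy q qf hqf, hcomm]

theorem apply_map_comm (hΨ : IsBoundedCalculus hv ω A Ψ) (hω : 0 ≤ ω) {T : X →L[ℂ] X}
    (hT : FunCalcEq hv ω A F T) (p : sobolevSpace hv ω) (y : X) : T (Ψ p y) = Ψ p (T y) :=
  (hT.mem_funCalc_iff.1 (hΨ.map_mem_funCalc hω p (hT.mem_funCalc_iff.2 rfl))).symm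

theorem map_sub_mem_funCalc (hΨ : IsBoundedCalculus hv ω A Ψ) (hω : 0 ≤ ω) {T : X →L[ℂ] X}
    (hT : FunCalcEq hv ω A F T) {p q : sobolevSpace hv ω}
    (hq : (q : strip ω → ℂ) = p * (F - f)) (y : X) :
    (Ψ p y, T (Ψ p y) - Ψ q y) ∈ funCalc hv ω A f := by
  rw [hΨ.mem_funCalc_iff hω]
  intro e ef hef
  let ep : sobolevSpace hv ω := ⟨_, mul_mem_sobolevSpace hv hω e.2 p.2⟩
  let e_q : sobolevSpace hv ω := ⟨_, mul_mem_sobolevSpace hv hω e.2 q.2⟩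
  let efp : sobolevSpace hv ω := ⟨_, mul_mem_sobolevSpace hv hω ef.2 p.2⟩
  have hepF : ((efp + e_q : sobolevSpace hv ω) : strip ω → ℂ) = ep * F := by
    simp only [Submodule.coe_add, ep, e_q, efp, hq, hef]
    ring
  calc Ψ e (T (Ψ p y) - Ψ q y) = Ψ ep (T y) - Ψ e_q y := by
        rw [map_sub, hΨ.apply_map_comm hω hT, hΨ.map_mul_apply (r := ep) rfl,
          hΨ.map_mul_apply (r := e_q) rfl]
    _ = Ψ (efp + e_q) y - Ψ e_q y := by
        rw [(hΨ.mem_funCalc_iff hω).1 (hT.mem_funCalc_iff.2 rfl) ep _ hepF]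
    _ = Ψ efp y := by rw [map_add, add_apply, add_sub_cancel_right]
    _ = Ψ ef (Ψ p y) := hΨ.map_mul_apply rfl y

theorem exists_tendsto_apply_map (hΨ : IsBoundedCalculus hv ω A Ψ) (hω : 0 ≤ ω)
    (hf : ∀ y, (0, y) ∈ funCalc hv ω A f → y = 0) {ι : Type*} {l : Filter ι} [l.NeBot]
    {F : ι → strip ω → ℂ} {T : ι → X →L[ℂ] X} (hT : ∀ i, FunCalcEq hv ω A (F i) (T i))
    {p : sobolevSpace hv ω}
    (hconv : Tendsto (fun i => sobolevNorm v ω (p * (F i - f))) l (𝓝 0)) (y : X) :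
    ∃ z, Tendsto (fun i => T i (Ψ p y)) l (𝓝 z) ∧ (Ψ p y, z) ∈ funCalc hv ω A f := by
  have hmem_sobolev (i : ι) (hi : sobolevNorm v ω (p * (F i - f)) < ∞) :
      ∃ q : sobolevSpace hv ω, (q : strip ω → ℂ) = p * (F i - f) :=
    ⟨⟨_, mem_sobolevSpace_of_sobolevNorm_lt_top hv hi⟩, rfl⟩
  choose! q hq using hmem_sobolev
  have hqF : ∀ᶠ i in l, (q i : strip ω → ℂ) = p * (F i - f) :=
    (hconv.eventually_lt_const ENNReal.zero_lt_top).mono hq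
  have hmem : ∀ᶠ i in l, (Ψ p y, T i (Ψ p y) - Ψ (q i) y) ∈ funCalc hv ω A f :=
    hqF.mono fun i hi => hΨ.map_sub_mem_funCalc hω (hT i) hi y
  obtain ⟨i₀, hi₀⟩ := hmem.exists
  refine ⟨_, ?_, hi₀⟩
  have hΨq : Tendsto (fun i => Ψ (q i) y) l (𝓝 0) :=
    ((ContinuousLinearMap.apply ℂ X y).continuous.tendsto' 0 0 (map_zero _)).comp
      (hΨ.tendsto_map_zero (hconv.congr' (hqF.mono fun i hi => congrArg _ hi.symm)))
  have hlim := hΨq.const_add (T i₀ (Ψ p y) - Ψ (q i₀) y)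
  rw [add_zero] at hlim
  refine hlim.congr' (hmem.mono fun i hi => ?_)
  have hconst := hf _ (by simpa using Submodule.sub_mem _ hi hi₀)
  rw [← sub_eq_zero.1 hconst, sub_add_cancel]

theorem exists_tendsto_apply_elemCalc (hΨ : IsBoundedCalculus hv ω A Ψ) (hω : 0 ≤ ω)
    (hf : ∀ y, (0, y) ∈ funCalc hv ω A f → y = 0) {ι : Type*} {l : Filter ι} [l.NeBot]
    {F : ι → strip ω → ℂ} {T : ι → X →L[ℂ] X} (hT : ∀ i, FunCalcEq hv ω A (F i) (T i))
    {ψ : ℂ → ℂ} (hψ : ψ ∈ elementaryGerm ω)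
    (hconv : Tendsto (fun i => sobolevNorm v ω (toStrip ω ψ * (F i - f))) l (𝓝 0)) (y : X) :
    ∃ z, Tendsto (fun i => T i (elemCalc ω A ψ y)) l (𝓝 z) ∧
      (elemCalc ω A ψ y, z) ∈ funCalc hv ω A f := by
  let p : sobolevSpace hv ω := ⟨_, toStrip_mem_sobolevSpace hv hω hψ⟩
  have hp : Ψ p = elemCalc ω A ψ := hΨ.map_eq_elemCalc hω hψ rfl
  rw [← hp]
  exact hΨ.exists_tendsto_apply_map hω hf hT (p := p) hconv y

end IsBoundedCalculus

end FunCalc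

end HorCalc

end

theorem mainTheorem12_general {X : Type*} [NormedAddCommGroup X] [NormedSpace ℂ X]
    [CompleteSpace X] {ω : ℝ} (hω : 0 ≤ ω) {v : ℝ → ℝ} (hv : HorCalc.StronglyAdmissible v)
    {A : X →ₗ.[ℂ] X} (hA : HorCalc.HasBoundedSobolevCalculus hv ω A) {f : HorCalc.strip ω → ℂ}
    (hf : ∀ y, (0, y) ∈ HorCalc.funCalc hv ω A f → y = 0) {ι : Type*} {l : Filter ι} [l.NeBot]
    {F : ι → HorCalc.strip ω → ℂ} {D : Set (ℂ → ℂ)} (hample : HorCalc.Ample ω A D)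
    (hconv : ∀ ψ ∈ D, Tendsto
      (fun i => HorCalc.sobolevNorm v ω (HorCalc.toStrip ω ψ * (F i - f))) l (𝓝 0))
    {T : ι → X →L[ℂ] X} (hT : ∀ i, HorCalc.FunCalcEq hv ω A (F i) (T i))
    (hbdd : ∃ C : ℝ, ∀ i, ‖T i‖ ≤ C) :
    ∃ S : X →L[ℂ] X, HorCalc.FunCalcEq hv ω A f S ∧
      ∀ x : X, Tendsto (fun i => T i x) l (𝓝 (S x)) := by
  obtain ⟨Ψ, hΨ⟩ := hA.exists_isBoundedCalculus
  obtain ⟨C, hC⟩ := hbdd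
  obtain ⟨hD, hdense⟩ := hample
  refine HorCalc.exists_graph_eq_and_tendsto hC (HorCalc.isClosed_funCalc f) hf
    (dense_iff_closure_eq.2 hdense) fun x hx => ?_
  simp only [Set.mem_iUnion, Set.mem_range] at hx
  obtain ⟨ψ, hψ, y, rfl⟩ := hx
  exact hΨ.exists_tendsto_apply_elemCalc hω hf hT (hD hψ) (hconv ψ hψ) y

theorem mainTheorem12 {X : Type*} [NormedAddCommGroup X] [NormedSpace ℂ X] [CompleteSpace X]
    (ω : ℝ) (hω : 0 ≤ ω) (v : ℝ → ℝ) (hv : HorCalc.StronglyAdmissible v)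
    (A : X →ₗ.[ℂ] X) (hA : HorCalc.HasBoundedSobolevCalculus hv ω A)
    (f : HorCalc.strip ω → ℂ) (hf : f ∈ HorCalc.horSpace v ω)
    (F : ℕ → HorCalc.strip ω → ℂ) (hF : ∀ n, F n ∈ HorCalc.horSpace v ω)
    (D : Set (ℂ → ℂ)) (hD : D ⊆ HorCalc.holSchwartzGerm ω) (hample : HorCalc.Ample ω A D)
    (hconv : ∀ ψ ∈ D, Tendsto
      (fun n => HorCalc.sobolevNorm v ω (HorCalc.toStrip ω ψ * (F n - f))) atTop (𝓝 0))
    (T : ℕ → X →L[ℂ] X) (hT : ∀ n, HorCalc.FunCalcEq hv ω A (F n) (T n))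
    (hbdd : ∃ C : ℝ, ∀ n, ‖T n‖ ≤ C) :
    ∃ S : X →L[ℂ] X, HorCalc.FunCalcEq hv ω A f S ∧
      ∀ x : X, Tendsto (fun n => T n x) atTop (𝓝 (S x)) := by
  obtain ⟨Ψ, hΨ⟩ := hA.exists_isBoundedCalculus
  exact mainTheorem12_general hω hv hA (fun _ => hΨ.eq_zero_of_zero_mem_funCalc hω hf) hample hconv
    hT hbdd
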